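/- **Setting.** A cumulative game with incomplete information $G$ (with finite signal sets) consists of non-empty finite action sets $A^1,A^2$, finite signal sets $S^1,S^2$, a daily payoff function $f:H\to\mathbb{R}$ on the set $H=\bigcup_{n\ge 0}(A^1\times A^2)^n$ of finite histories, and probability distributions $p^1_h\in\Delta(S^1)$, $p^2_h\in\Delta(S^2)$ for every $h\in H$. At each stage the players choose actions simultaneously; the current history is extended by the pair of actions to a history $h$, and a signal pair is drawn from $p^1_h\times p^2_h$, player $i$ observing only his own action and his signal $s^i$. A (behavioral) strategy of player $i$ is a function $\sigma^i:\bigcup_n(A^i\times S^i)^n\to\Delta(A^i)$. A profile $(\sigma^1,\sigma^2)$ induces a probability measure $\mu_{\sigma^1,\sigma^2}$ on infinite plays. A stop rule of player 1 (the Maximizer) is a function $s:(A^1\times S^1)^{\mathbb{N}}\to\mathbb{N}$ such that if $s(h)=n$ and $h'$ coincides with $h$ in the first $n$ coordinates, then $s(h')=n$. In the leavable game $L(G)$ the Minimizer (player 2) chooses a strategy $\sigma^2$, and the Maximizer chooses a strategy $\sigma^1$ together with a stop rule $s$, which may be randomized independently of the play (that is, he chooses a probability distribution over stop rules). The payoff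 is $\sum_{i=0}^{s(h^1)}f(h_i)$, where $h_i$ is the history of length $i$ and $h^1$ the Maximizer's infinite private history, and the expected payoff is taken with respect to $\mu_{\sigma^1,\sigma^2}$ and the distribution of $s$. The game is bounded if the payoff is bounded: there is $B$ such that $\left|\sum_{i=0}^n f(h_i)\right|<B$ for every infinite history and every $n$. For $n\ge0$, $L_n$ is the same game in which the Maximizer may only use stop rules that are $\le n$ everywhere. The value of a Maximizer's (Minimizer's) strategy is the infimum (supremum) of the expected payoff over all strategies of the opponent. The game has value $v$ if the supremum of the values of the Maximizer's strategies and the infimum of the values of the Minimizer's strategies are both equal to $v$. A strategy is $\epsilon$-optimal if its value differs from $v$ by less than $\epsilon$, and optimal if its value is $v$. The value is uniform if for every $\epsilon>0$ there are $N$ and one pair of strategies, one for each player, that are $\epsilon$-optimal in $L(G)$ and in every $L_n$ with $n>N$ (in particular these $L_n$ have values, and the Maximizer's strategy is allowed in them). **Theorem 3.** Every bounded leavable game with incomplete information and finite signal sets has a value, and that value is uniform. Furthermore, an optimal strategy exists for the Minimizer. If moreover $f\ge 0$, the same conclusions hold when the Maximizer may use only non-randomized stop rules (in $L(G)$ and in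 all $L_n$). -/

import Mathlib

open MeasureTheory ProbabilityTheory

/-! ### Zero-sum games in strategic form, with a family of restrictions on the Maximizer

`pay x y` is the (expected) payoff when the Maximizer uses `x : X` and the Minimizer uses `y : Y`;
`D : Set X` is the set of strategies that the Maximizer is allowed to use.  Values are taken in the
extended reals, so that every infimum and supremum below is a genuine one. -/

namespace ZeroSum

variable {X Y : Type*}

/-- The value of a strategy of the Maximizer: the infimum of the payoff over the strategies of the
Minimizer. -/
noncomputable def maxVal (pay : X → Y → ℝ) (x : X) : EReal := ⨅ y : Y, (pay x y : EReal)

/-- The value of a strategy of the Minimizer: the supremum of the payoff over the allowed strategies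
of the Maximizer. -/
noncomputable def minVal (pay : X → Y → ℝ) (D : Set X) (y : Y) : EReal :=
  ⨆ x ∈ D, (pay x y : EReal)

/-- The lower value. -/
noncomputable def lowerVal (pay : X → Y → ℝ) (D : Set X) : EReal := ⨆ x ∈ D, maxVal pay x

/-- The upper value. -/
noncomputable def upperVal (pay : X → Y → ℝ) (D : Set X) : EReal := ⨅ y : Y, minVal pay D y

/-- The (finite) real number `v` is the value of the game. -/
def IsValue (pay : X → Y → ℝ) (D : Set X) (v : ℝ) : Prop :=
  lowerVal pay D = (v : EReal) ∧ upperVal pay D = (v : EReal)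

/-- `x` is an `ε`-optimal strategy of the Maximizer: it is allowed, the game has a value `v`,
and the value of `x` differs from `v` by less than `ε`. -/
def EpsOptimalMax (pay : X → Y → ℝ) (D : Set X) (ε : ℝ) (x : X) : Prop :=
  x ∈ D ∧ ∃ v : ℝ, IsValue pay D v ∧
    ((v - ε : ℝ) : EReal) < maxVal pay x ∧ maxVal pay x < ((v + ε : ℝ) : EReal)

/-- `y` is an `ε`-optimal strategy of the Minimizer. -/
def EpsOptimalMin (pay : X → Y → ℝ) (D : Set X) (ε : ℝ) (y : Y) : Prop :=
  ∃ v : ℝ, IsValue pay D v ∧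
    ((v - ε : ℝ) : EReal) < minVal pay D y ∧ minVal pay D y < ((v + ε : ℝ) : EReal)

/-- `y` is an optimal strategy of the Minimizer: the game has a value, and `y` has that value. -/
def OptimalMin (pay : X → Y → ℝ) (D : Set X) (y : Y) : Prop :=
  ∃ v : ℝ, IsValue pay D v ∧ minVal pay D y = (v : EReal)

/-- The game in which the Maximizer is unrestricted has a uniform value with respect to the
truncated games, the `n`-th of which restricts the Maximizer to `D n`: it has a value, and for every
`ε > 0` there are one `N` and one pair of strategies that are `ε`-optimal in the game itself and in
every `n`-th truncated game with `n > N` (in particular these truncated games have values). -/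
def HasUniformValue (pay : X → Y → ℝ) (D : ℕ → Set X) : Prop :=
  (∃ v : ℝ, IsValue pay Set.univ v) ∧
  ∀ ε : ℝ, 0 < ε → ∃ (N : ℕ) (x : X) (y : Y),
    EpsOptimalMax pay Set.univ ε x ∧ EpsOptimalMin pay Set.univ ε y ∧
    ∀ n : ℕ, N < n → EpsOptimalMax pay (D n) ε x ∧ EpsOptimalMin pay (D n) ε y

end ZeroSum

/-! ### Cumulative games with incomplete information -/

/-- A cumulative game with incomplete information, with action sets `A₁`, `A₂` and signal sets
`S₁`, `S₂`.  A finite history is a list of pairs of actions, oldest first. -/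
structure CumulativeGame (A₁ A₂ S₁ S₂ : Type*) where
  /-- the daily payoff -/
  f : List (A₁ × A₂) → ℝ
  /-- the law of the signal to player 1 when the current history is `h` -/
  p₁ : List (A₁ × A₂) → PMF S₁
  /-- the law of the signal to player 2 when the current history is `h` -/
  p₂ : List (A₁ × A₂) → PMF S₂

/-- A behavioral strategy of a player with actions `A` and signals `S`: a mixed action for every
finite private history (a list of pairs of own action and own signal, oldest first). -/
abbrev BehavioralStrategy (A S : Type*) := List (A × S) → PMF A

/-- A stop rule of a player with actions `A` and signals `S`: a function from infinite private
histories to `ℕ` for which the event of stopping at `n` depends on the first `n` coordinates. -/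
structure StopRule (A S : Type*) where
  /-- the stopping time -/
  time : (ℕ → A × S) → ℕ
  nonanticipating : ∀ h h' : ℕ → A × S, (∀ k < time h, h' k = h k) → time h' = time h

/-- What happens in one stage: the two actions, then the two signals. -/
@[ext]
structure Stage (A₁ A₂ S₁ S₂ : Type*) where
  a₁ : A₁
  a₂ : A₂
  s₁ : S₁
  s₂ : S₂

namespace Stage

variable {A₁ A₂ S₁ S₂ : Type*}

instance : MeasurableSpace (Stage A₁ A₂ S₁ S₂) := ⊤

instance : DiscreteMeasurableSpace (Stage A₁ A₂ S₁ S₂) := ⟨fun _ => trivial⟩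

instance [Finite A₁] [Finite A₂] [Finite S₁] [Finite S₂] : Finite (Stage A₁ A₂ S₁ S₂) :=
  Finite.of_injective (fun x => (x.a₁, x.a₂, x.s₁, x.s₂)) (by
    intro x y h
    simp only [Prod.mk.injEq] at h
    exact Stage.ext h.1 h.2.1 h.2.2.1 h.2.2.2)

/-- The pair of actions. -/
def actions (x : Stage A₁ A₂ S₁ S₂) : A₁ × A₂ := (x.a₁, x.a₂)

/-- What player 1 sees. -/
def view₁ (x : Stage A₁ A₂ S₁ S₂) : A₁ × S₁ := (x.a₁, x.s₁)

/-- What player 2 sees. -/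
def view₂ (x : Stage A₁ A₂ S₁ S₂) : A₂ × S₂ := (x.a₂, x.s₂)

end Stage

namespace CumulativeGame

variable {A₁ A₂ S₁ S₂ : Type*} (G : CumulativeGame A₁ A₂ S₁ S₂)

/-- The law of the next stage after the stages `l`: the players choose actions independently
according to their private histories, the history is extended by the two actions, and the two signals
are drawn independently according to the resulting current history. -/
noncomputable def stageLaw (σ₁ : BehavioralStrategy A₁ S₁) (σ₂ : BehavioralStrategy A₂ S₂)
    (l : List (Stage A₁ A₂ S₁ S₂)) : PMF (Stage A₁ A₂ S₁ S₂) :=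
  (σ₁ (l.map Stage.view₁)).bind fun a =>
  (σ₂ (l.map Stage.view₂)).bind fun b =>
  (G.p₁ (l.map Stage.actions ++ [(a, b)])).bind fun s =>
  (G.p₂ (l.map Stage.actions ++ [(a, b)])).bind fun t =>
  PMF.pure ⟨a, b, s, t⟩

section Law

variable [Finite A₁] [Finite A₂] [Finite S₁] [Finite S₂]

/-- The transition kernel from stages `0, …, n` to stage `n + 1`. -/
noncomputable def stageKernel (σ₁ : BehavioralStrategy A₁ S₁) (σ₂ : BehavioralStrategy A₂ S₂)
    (n : ℕ) : Kernel (Π _ : Finset.Iic n, Stage A₁ A₂ S₁ S₂) (Stage A₁ A₂ S₁ S₂) :=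
  Kernel.ofFunOfCountable fun x =>
    (G.stageLaw σ₁ σ₂ (List.ofFn fun i : Fin (n + 1) =>
      x ⟨i, Finset.mem_Iic.2 (Nat.lt_succ_iff.1 i.2)⟩)).toMeasure

instance (σ₁ : BehavioralStrategy A₁ S₁) (σ₂ : BehavioralStrategy A₂ S₂) (n : ℕ) :
    IsMarkovKernel (G.stageKernel σ₁ σ₂ n) :=
  ⟨fun _ => PMF.toMeasure.isProbabilityMeasure _⟩

/-- The probability measure on infinite plays (actions and signals) induced by a profile. -/
noncomputable def playLaw (σ₁ : BehavioralStrategy A₁ S₁) (σ₂ : BehavioralStrategy A₂ S₂) :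
    Measure (ℕ → Stage A₁ A₂ S₁ S₂) :=
  Kernel.trajMeasure (X := fun _ => Stage A₁ A₂ S₁ S₂)
    (G.stageLaw σ₁ σ₂ []).toMeasure (G.stageKernel σ₁ σ₂)

end Law

/-- The payoff cumulated along the infinite history `h` up to time `n` inclusive. -/
noncomputable def cumulated (h : ℕ → A₁ × A₂) (n : ℕ) : ℝ :=
  ∑ i ∈ Finset.range (n + 1), G.f (List.ofFn fun k : Fin i => h k)

/-- The leavable game is bounded: its payoff, the payoff cumulated up to the time at which the
Maximizer stops, is bounded. -/
def LeavableBounded : Prop :=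
  ∃ B : ℝ, ∀ (h : ℕ → A₁ × A₂) (n : ℕ), |G.cumulated h n| < B

section Leavable

variable [Finite A₁] [Finite A₂] [Finite S₁] [Finite S₂]

/-- The expected payoff of the leavable game when the Maximizer (player 1) uses the behavioral
strategy and the stop rule in `x`, and the Minimizer uses `σ₂`. -/
noncomputable def leavablePay (x : BehavioralStrategy A₁ S₁ × StopRule A₁ S₁)
    (σ₂ : BehavioralStrategy A₂ S₂) : ℝ :=
  ∫ ω, G.cumulated (fun k => (ω k).actions) (x.2.time fun k => (ω k).view₁)
    ∂(G.playLaw x.1 σ₂)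

/-- The expected payoff when the Maximizer uses a behavioral strategy and, independently, a random
stop rule.  (With finite `A₁` and `S₁` there are only countably many stop rules, so `PMF` covers
every way to randomize.) -/
noncomputable def randomizedLeavablePay
    (x : BehavioralStrategy A₁ S₁ × PMF (StopRule A₁ S₁))
    (σ₂ : BehavioralStrategy A₂ S₂) : ℝ :=
  ∑' s : StopRule A₁ S₁, (x.2 s).toReal * G.leavablePay (x.1, s) σ₂

end Leavable

end CumulativeGame

/-- The Maximizer's strategies in the `n`-th truncated leavable game: stop rules `≤ n`. -/
def StopsBy (A S : Type*) (n : ℕ) : Set (BehavioralStrategy A S × StopRule A S) :=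
  {x | ∀ h, x.2.time h ≤ n}

/-- The Maximizer's strategies in the `n`-th truncated leavable game, with random stop rules. -/
def RandomlyStopsBy (A S : Type*) (n : ℕ) : Set (BehavioralStrategy A S × PMF (StopRule A S)) :=
  {x | ∀ s ∈ x.2.support, ∀ h, s.time h ≤ n}

/-! A minimax theorem gives each truncated game a value `v n` and an optimal strategy of the
Minimizer. Its three hypotheses rest on `planPay`: in a truncated game the payoff is a finite sum,
affine in the products of probability of continuing, reach weight of player 1 and reach weight of
player 2. Mixtures of either player's strategies are realized by behavioral strategies as in Kuhn's
theorem; for the Maximizer the posterior also conditions on not having stopped, and the resulting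
probabilities of continuing come from a random stop rule (`exists_survival_eq`). The Minimizer's
strategies are compact under pointwise convergence, and the payoff is continuous in them.

The values `v n` increase to a limit `V`. By compactness one strategy of the Minimizer holds all
truncated games down to `V`. With finitely many actions and signals every stop rule is bounded
(`StopRule.exists_time_le`), so the same strategy guarantees `V` in the whole game. A Maximizer's
strategy good in the `N`-th game is still allowed later, and what it guarantees does not depend on
the truncation; hence uniformity.

If `f ≥ 0`, stopping as late as possible dominates, so non-randomized rules give the same truncated
values. -/

namespace ZeroSum

/-! ### Minimax by separation and compactness; the limit of truncated games. -/

variable {X Y : Type*}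

/-- Any family of upper bounds on the payoffs of strategies in `D` that can be met finitely many at a
time by the Minimizer can be met simultaneously. -/
def CompactMin (pay : X → Y → ℝ) (D : Set X) : Prop :=
  ∀ E : Set (X × ℝ), (∀ p ∈ E, p.1 ∈ D) →
    (∀ F : Finset (X × ℝ), ↑F ⊆ E → ∃ y, ∀ p ∈ F, pay p.1 y ≤ p.2) →
    ∃ y, ∀ p ∈ E, pay p.1 y ≤ p.2

/-- Finite mixtures of allowed strategies of the Maximizer are dominated by allowed strategies. -/
def ConcaveMax (pay : X → Y → ℝ) (D : Set X) : Prop :=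
  ∀ (F : Finset X) (w : X → ℝ), ↑F ⊆ D → (∀ x ∈ F, 0 ≤ w x) → ∑ x ∈ F, w x = 1 →
    ∃ x' ∈ D, ∀ y, ∑ x ∈ F, w x * pay x y ≤ pay x' y

/-- Mixtures of two strategies of the Minimizer are dominated by a strategy. -/
def ConvexMin (pay : X → Y → ℝ) (D : Set X) : Prop :=
  ∀ (y y' : Y) (a b : ℝ), 0 ≤ a → 0 ≤ b → a + b = 1 →
    ∃ y'', ∀ x ∈ D, pay x y'' ≤ a * pay x y + b * pay x y'

theorem CompactMin.mono {pay : X → Y → ℝ} {D D' : Set X} (h : CompactMin pay D) (hD : D' ⊆ D) :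
    CompactMin pay D' := fun E hE hF => h E (fun p hp => hD (hE p hp)) hF

theorem lowerVal_le_upperVal (pay : X → Y → ℝ) (D : Set X) : lowerVal pay D ≤ upperVal pay D :=
  iSup₂_le fun x hx => le_iInf fun y =>
    (iInf_le (fun y => (pay x y : EReal)) y).trans
      (le_iSup₂ (f := fun x (_ : x ∈ D) => (pay x y : EReal)) x hx)

theorem lowerVal_mono (pay : X → Y → ℝ) {D D' : Set X} (h : D ⊆ D') :
    lowerVal pay D ≤ lowerVal pay D' := biSup_mono h

theorem maxVal_le_lowerVal (pay : X → Y → ℝ) {D : Set X} {x : X} (hx : x ∈ D) :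
    maxVal pay x ≤ lowerVal pay D := le_iSup₂ (f := fun x (_ : x ∈ D) => maxVal pay x) x hx

theorem upperVal_le_minVal (pay : X → Y → ℝ) (D : Set X) (y : Y) :
    upperVal pay D ≤ minVal pay D y := iInf_le _ y

theorem minVal_le_coe_iff {pay : X → Y → ℝ} {D : Set X} {y : Y} {c : ℝ} :
    minVal pay D y ≤ c ↔ ∀ x ∈ D, pay x y ≤ c := by
  simp [minVal]

theorem coe_le_maxVal_iff {pay : X → Y → ℝ} {x : X} {c : ℝ} :
    (c : EReal) ≤ maxVal pay x ↔ ∀ y, c ≤ pay x y := by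
  simp [maxVal]

/-- Either some mixture of finitely many payoff functions is at least `c`, or the Minimizer can bring
them all below `c` simultaneously. -/
theorem exists_weights_or_exists_forall_le {pay : X → Y → ℝ} {D : Set X}
    (hmin : ConvexMin pay D) [Nonempty Y] (F : Finset X) (hF : ↑F ⊆ D) (c : ℝ)
    (h : ¬ ∃ y, ∀ x ∈ F, pay x y ≤ c) :
    ∃ w : X → ℝ, (∀ x ∈ F, 0 ≤ w x) ∧ ∑ x ∈ F, w x = 1 ∧
      ∀ y, c ≤ ∑ x ∈ F, w x * pay x y := by
  classical
  -- The vectors of bounds that the Minimizer can meet form a convex set, closed upwards; by `h` it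
  -- misses the open orthant `T`. The weights are a normalized separating functional.
  set C : Set (F → ℝ) := {z | ∃ y, ∀ i : F, pay i y ≤ z i} with hC
  set T : Set (F → ℝ) := Set.univ.pi fun _ => Set.Iio c with hT
  have hTc : Convex ℝ T := convex_pi fun i _ => convex_Iio c
  have hTo : IsOpen T := isOpen_set_pi Set.finite_univ fun i _ => isOpen_Iio
  have hCc : Convex ℝ C := by
    rintro z ⟨y, hy⟩ z' ⟨y', hy'⟩ a b ha hb hab
    obtain ⟨y'', h''⟩ := hmin y y' a b ha hb hab
    refine ⟨y'', fun i => (h'' i (hF i.2)).trans ?_⟩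
    simp only [Pi.add_apply, Pi.smul_apply, smul_eq_mul]
    have := mul_le_mul_of_nonneg_left (hy i) ha
    have := mul_le_mul_of_nonneg_left (hy' i) hb
    linarith
  have hdisj : Disjoint T C := by
    rw [Set.disjoint_left]
    rintro z hz ⟨y, hy⟩
    exact h ⟨y, fun x hx => (hy ⟨x, hx⟩).trans (le_of_lt (hz ⟨x, hx⟩ trivial))⟩
  obtain ⟨φ, u, hφT, hφC⟩ := geometric_hahn_banach_open hTc hTo hCc hdisj
  set e : F → F → ℝ := fun i => Pi.single i 1 with he
  have hφ : ∀ z, φ z = ∑ i, z i * φ (e i) := by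
    intro z
    conv_lhs => rw [pi_eq_sum_univ' z, map_sum]
    refine Finset.sum_congr rfl fun i _ => ?_
    rw [map_smul, smul_eq_mul]
  obtain ⟨y₀⟩ := ‹Nonempty Y›
  have hz₀ : ∀ z : F → ℝ, (∀ i : F, pay i y₀ ≤ z i) → u ≤ φ z := fun z hz => hφC z ⟨y₀, hz⟩
  -- `C` is closed upwards, so a negative coefficient would make `φ` unbounded below on `C`.
  have hw : ∀ i, 0 ≤ φ (e i) := by
    intro i
    by_contra hneg
    push Not at hneg
    set z : F → ℝ := fun i => pay i y₀ with hz
    obtain ⟨t, ht⟩ := exists_nat_gt ((φ z - u) / (-φ (e i)))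
    have h1 := hz₀ (z + (t : ℝ) • e i) fun j => by
      simp only [hz, Pi.add_apply, Pi.smul_apply, smul_eq_mul, he, Pi.single_apply]
      split_ifs <;> simp
    rw [map_add, map_smul, smul_eq_mul] at h1
    rw [div_lt_iff₀ (by linarith)] at ht
    linarith
  set S := ∑ i, φ (e i) with hS
  have hTu : ∀ ε > 0, (c - ε) * S < u := by
    intro ε hε
    have := hφT (fun _ => c - ε) (fun i _ => by simp [hε])
    rwa [hφ, ← Finset.mul_sum] at this
  have hSpos : 0 < S := by
    rcases (Finset.sum_nonneg fun i _ => hw i : 0 ≤ S).lt_or_eq with h' | h'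
    · exact h'
    · have h0 : ∀ i, φ (e i) = 0 := fun i =>
        (Finset.sum_eq_zero_iff_of_nonneg fun i _ => hw i).1 h'.symm i (Finset.mem_univ i)
      have h1 := hTu 1 one_pos
      have h2 := hz₀ (fun i => pay i y₀) fun _ => le_rfl
      rw [hφ] at h2
      simp only [h0, mul_zero, Finset.sum_const_zero] at h2
      rw [hS, ← h', mul_zero] at h1
      linarith
  have hcu : c * S ≤ u := by
    by_contra hlt
    push Not at hlt
    -- This value of `ε` makes `(c - ε) * S` equal to `u`, against the strict inequality.
    have := hTu ((c * S - u) / S) (div_pos (by linarith) hSpos)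
    rw [sub_mul, div_mul_cancel₀ _ hSpos.ne'] at this
    linarith
  refine ⟨fun x => if hx : x ∈ F then φ (e ⟨x, hx⟩) / S else 0, ?_, ?_, ?_⟩
  · intro x hx
    simp only [hx, dif_pos]
    exact div_nonneg (hw _) hSpos.le
  · rw [← Finset.sum_attach]
    simp only [Finset.coe_mem, dif_pos, Subtype.coe_eta]
    rw [← Finset.sum_div, div_eq_one_iff_eq hSpos.ne', hS]
    rfl
  · intro y
    have h1 := hφC (fun i => pay i y) ⟨y, fun _ => le_rfl⟩
    rw [hφ] at h1
    rw [← Finset.sum_attach]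
    simp only [Finset.coe_mem, dif_pos, Subtype.coe_eta]
    have h2 : ∑ x ∈ F.attach, φ (e x) / S * pay x y = (∑ i : F, pay i y * φ (e i)) / S := by
      rw [Finset.sum_div]
      refine Finset.sum_congr rfl fun i _ => by ring
    rw [h2, le_div_iff₀ hSpos]
    exact hcu.trans h1

/-- A minimax theorem for payoffs that are concavelike in the strategy of the Maximizer, convexlike
in the strategy of the Minimizer, and compact on the side of the Minimizer. -/
theorem exists_isValue_and_minVal_eq {pay : X → Y → ℝ} {D : Set X} [Nonempty Y]
    (hD : D.Nonempty) {B : ℝ} (hB : ∀ x ∈ D, ∀ y, |pay x y| ≤ B)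
    (hmax : ConcaveMax pay D) (hmin : ConvexMin pay D) (hcomp : CompactMin pay D) :
    ∃ v : ℝ, IsValue pay D v ∧ ∃ y, minVal pay D y = v := by
  classical
  -- If every finite subfamily can be held to `c`, compactness serves the Minimizer; otherwise
  -- separation on a failing subfamily yields a mixture, which the Maximizer realizes.
  have key : ∀ c : ℝ, (∃ y, ∀ x ∈ D, pay x y ≤ c) ∨ ∃ x ∈ D, ∀ y, c ≤ pay x y := by
    intro c
    by_cases h : ∀ F : Finset X, ↑F ⊆ D → ∃ y, ∀ x ∈ F, pay x y ≤ c
    · left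
      obtain ⟨y, hy⟩ := hcomp ((fun x => (x, c)) '' D) (by rintro _ ⟨x, hx, rfl⟩; exact hx) (by
        intro F hF
        obtain ⟨y, hy⟩ := h (F.image Prod.fst) (by
          intro x hx
          obtain ⟨p, hp, rfl⟩ := Finset.mem_image.1 hx
          obtain ⟨x', hx', rfl⟩ := hF hp
          exact hx')
        refine ⟨y, fun p hp => ?_⟩
        have h1 := hy p.1 (Finset.mem_image_of_mem _ hp)
        obtain ⟨x, hx, rfl⟩ := hF hp
        exact h1)
      exact ⟨y, fun x hx => hy (x, c) ⟨x, hx, rfl⟩⟩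
    · right
      push Not at h
      obtain ⟨F, hF, hy⟩ := h
      obtain ⟨w, hw0, hw1, hw⟩ := exists_weights_or_exists_forall_le hmin F hF c (by
        push Not; exact hy)
      obtain ⟨x, hx, hxy⟩ := hmax F w hF hw0 hw1
      exact ⟨x, hx, fun y => (hw y).trans (hxy y)⟩
  obtain ⟨y₀⟩ := id ‹Nonempty Y›
  set L : Set ℝ := {c | ∃ x ∈ D, ∀ y, c ≤ pay x y} with hL
  have hne : L.Nonempty := by
    obtain ⟨x, hx⟩ := hD
    exact ⟨-B, x, hx, fun y => (abs_le.1 (hB x hx y)).1⟩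
  have hbdd : BddAbove L := ⟨B, by
    rintro c ⟨x, hx, h⟩
    exact (h y₀).trans (abs_le.1 (hB x hx y₀)).2⟩
  set v := sSup L with hv
  have hlow_le : lowerVal pay D ≤ v := by
    refine iSup₂_le fun x hx => ?_
    by_contra hlt
    push Not at hlt
    obtain ⟨c, h1, h2⟩ := EReal.lt_iff_exists_real_btwn.1 hlt
    have : c ∈ L := ⟨x, hx, coe_le_maxVal_iff.1 h2.le⟩
    exact absurd (le_csSup hbdd this) (not_le.2 (EReal.coe_lt_coe_iff.1 h1))
  have hle_low : (v : EReal) ≤ lowerVal pay D := by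
    by_contra hlt
    push Not at hlt
    obtain ⟨c, h1, h2⟩ := EReal.lt_iff_exists_real_btwn.1 hlt
    obtain ⟨c', ⟨x, hx, h⟩, hc'⟩ := exists_lt_of_lt_csSup hne (EReal.coe_lt_coe_iff.1 h2)
    have h3 : (c' : EReal) ≤ lowerVal pay D :=
      (coe_le_maxVal_iff.2 h).trans (maxVal_le_lowerVal pay hx)
    exact absurd (h1.trans (EReal.coe_lt_coe_iff.2 hc')) (not_lt.2 h3)
  -- The Maximizer need not attain `v`, so `key` only applies above `v`. Compactness combines all
  -- the bounds `c > v`; finitely many of them follow from the smallest.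
  obtain ⟨y, hy⟩ : ∃ y, ∀ x ∈ D, pay x y ≤ v := by
    obtain ⟨y, hy⟩ := hcomp {p | p.1 ∈ D ∧ v < p.2} (fun p hp => hp.1) (by
      intro F hF
      obtain ⟨c, hvc, hc⟩ : ∃ c, v < c ∧ ∀ p ∈ F, c ≤ p.2 := by
        rcases F.eq_empty_or_nonempty with rfl | hne
        · exact ⟨v + 1, by linarith, by simp⟩
        · obtain ⟨p, hp, hmin⟩ := F.exists_min_image (fun p => p.2) hne
          exact ⟨p.2, (hF hp).2, hmin⟩
      rcases key c with ⟨y, hy⟩ | h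
      · exact ⟨y, fun p hp => (hy _ (hF hp).1).trans (hc p hp)⟩
      · exact absurd (le_csSup hbdd h) (not_le.2 hvc))
    refine ⟨y, fun x hx => le_of_forall_gt_imp_ge_of_dense fun c hc => hy (x, c) ⟨hx, hc⟩⟩
  have h1 : minVal pay D y ≤ v := minVal_le_coe_iff.2 hy
  have h2 := hle_low.trans (lowerVal_le_upperVal pay D)
  have h3 := upperVal_le_minVal pay D y
  exact ⟨v, ⟨le_antisymm hlow_le hle_low, le_antisymm (h3.trans h1) h2⟩, y,
    le_antisymm h1 (h2.trans h3)⟩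

/-- If the truncated games have values and optimal strategies of the Minimizer, and what the
Minimizer guarantees in all of them he guarantees in the game itself, then the value is uniform. -/
theorem hasUniformValue_and_exists_optimalMin {pay : X → Y → ℝ} {D : ℕ → Set X}
    (hmono : Monotone D) {B : ℝ} (hB : ∀ x y, |pay x y| ≤ B)
    (hval : ∀ n, ∃ v : ℝ, IsValue pay (D n) v ∧ ∃ y, minVal pay (D n) y = v)
    (hcomp : CompactMin pay (⋃ n, D n))
    (htail : ∀ y c, (∀ n, ∀ x ∈ D n, pay x y ≤ c) → ∀ x, pay x y ≤ c) :
    HasUniformValue pay D ∧ ∃ y, OptimalMin pay Set.univ y := by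
  classical
  choose v hv yn hyn using hval
  have hvB : BddAbove (Set.range v) := ⟨B, by
    rintro _ ⟨n, rfl⟩
    have : ((v n : ℝ) : EReal) ≤ B := by
      rw [← hyn n]
      exact minVal_le_coe_iff.2 fun x _ => (abs_le.1 (hB x (yn n))).2
    exact_mod_cast this⟩
  set V := ⨆ n, v n with hV
  have hvV : ∀ n, v n ≤ V := le_ciSup hvB
  have hvn : ∀ n, ∀ x ∈ D n, pay x (yn n) ≤ v n := fun n => minVal_le_coe_iff.1 (hyn n).le
  have hvmono : Monotone v := fun m n hmn => by
    have := lowerVal_mono pay (hmono hmn)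
    rw [(hv m).1, (hv n).1] at this
    exact_mod_cast this
  -- Finitely many strategies lie in a single `D n`, where `yn n` holds them to `v n ≤ V`.
  obtain ⟨y, hy⟩ := hcomp {p | p.1 ∈ ⋃ n, D n ∧ p.2 = V} (fun p hp => hp.1) (by
    intro F hF
    obtain ⟨n, hn⟩ : ∃ n, ∀ p ∈ F, p.1 ∈ D n := by
      choose! k hk using fun p (hp : p ∈ F) => Set.mem_iUnion.1 (hF hp).1
      exact ⟨F.sup k, fun p hp => hmono (Finset.le_sup hp) (hk p hp)⟩
    exact ⟨yn n, fun p hp => ((hvn n _ (hn p hp)).trans (hvV n)).trans (hF hp).2.ge⟩)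
  have hyV : ∀ x, pay x y ≤ V := htail y V fun n x hx =>
    hy (x, V) ⟨Set.mem_iUnion.2 ⟨n, hx⟩, rfl⟩
  have hmin : ∀ D, minVal pay D y ≤ V := fun D => minVal_le_coe_iff.2 fun x _ => hyV x
  have hlow : (V : EReal) ≤ lowerVal pay Set.univ := by
    by_contra hlt
    push Not at hlt
    obtain ⟨c, h1, h2⟩ := EReal.lt_iff_exists_real_btwn.1 hlt
    obtain ⟨n, hn⟩ := exists_lt_of_lt_ciSup (EReal.coe_lt_coe_iff.1 h2)
    have h3 : ((v n : ℝ) : EReal) ≤ lowerVal pay Set.univ := by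
      rw [← (hv n).1]
      exact lowerVal_mono pay (Set.subset_univ _)
    exact absurd (h1.trans (EReal.coe_lt_coe_iff.2 hn)) (not_lt.2 h3)
  have h2 := hlow.trans (lowerVal_le_upperVal pay Set.univ)
  have h3 := upperVal_le_minVal pay Set.univ y
  have hVal : IsValue pay Set.univ V :=
    ⟨le_antisymm ((lowerVal_le_upperVal _ _).trans (h3.trans (hmin _))) hlow,
      le_antisymm (h3.trans (hmin _)) h2⟩
  have hyval : minVal pay Set.univ y = V := le_antisymm (hmin _) (h2.trans h3)
  refine ⟨⟨⟨V, hVal⟩, fun ε hε => ?_⟩, y, V, hVal, hyval⟩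
  -- For `n > N` the values satisfy `V - ε < v N ≤ v n ≤ V`, which makes both `x` and `y`
  -- `ε`-optimal there.
  obtain ⟨N, hN⟩ := exists_lt_of_lt_ciSup (show V - ε < V by linarith)
  have hNlow : ((V - ε : ℝ) : EReal) < lowerVal pay (D N) := by
    rw [(hv N).1]
    exact EReal.coe_lt_coe_iff.2 hN
  obtain ⟨x, hx⟩ := lt_iSup_iff.1 hNlow
  obtain ⟨hxD, hx⟩ := lt_iSup_iff.1 hx
  refine ⟨N, x, y, ⟨trivial, V, hVal, hx, ?_⟩, ⟨V, hVal, ?_, ?_⟩, fun n hn => ⟨⟨hmono hn.le hxD,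
    v n, hv n, ?_, ?_⟩, v n, hv n, ?_, ?_⟩⟩
  · refine (maxVal_le_lowerVal pay (Set.mem_univ x)).trans_lt ?_
    rw [hVal.1]
    exact EReal.coe_lt_coe_iff.2 (by linarith)
  · rw [hyval]
    exact EReal.coe_lt_coe_iff.2 (by linarith)
  · rw [hyval]
    exact EReal.coe_lt_coe_iff.2 (by linarith)
  · refine lt_of_le_of_lt (EReal.coe_le_coe_iff.2 ?_) hx
    linarith [hvV n]
  · refine (maxVal_le_lowerVal pay (hmono hn.le hxD)).trans_lt ?_
    rw [(hv n).1]
    exact EReal.coe_lt_coe_iff.2 (by linarith)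
  · refine lt_of_lt_of_le ?_ (upperVal_le_minVal pay (D n) y)
    rw [(hv n).2]
    exact EReal.coe_lt_coe_iff.2 (by linarith)
  · refine (hmin _).trans_lt (EReal.coe_lt_coe_iff.2 ?_)
    linarith [hvmono hn.le]

end ZeroSum

/-! ### Sums over histories and products of weights along them. -/

/-- The sum of `g` over all lists of length `k`. -/
def sumLists {α : Type*} [Fintype α] : ℕ → (List α → ℝ) → ℝ
  | 0, g => g []
  | k + 1, g => sumLists k fun l => ∑ x, g (l ++ [x])

namespace sumLists

variable {α : Type*} [Fintype α]

theorem congr {k : ℕ} {g g' : List α → ℝ} (h : ∀ l, l.length = k → g l = g' l) :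
    sumLists k g = sumLists k g' := by
  induction k generalizing g g' with
  | zero => exact h [] rfl
  | succ k ih => exact ih fun l hl => Finset.sum_congr rfl fun x _ => h _ (by simp [hl])

theorem mono {k : ℕ} {g g' : List α → ℝ} (h : ∀ l, l.length = k → g l ≤ g' l) :
    sumLists k g ≤ sumLists k g' := by
  induction k generalizing g g' with
  | zero => exact h [] rfl
  | succ k ih => exact ih fun l hl => Finset.sum_le_sum fun x _ => h _ (by simp [hl])

theorem hasSum {ι : Type*} (k : ℕ) {g : ι → List α → ℝ} {g' : List α → ℝ}
    (h : ∀ l, HasSum (fun i => g i l) (g' l)) :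
    HasSum (fun i => sumLists k (g i)) (sumLists k g') := by
  induction k generalizing g g' with
  | zero => exact h []
  | succ k ih => exact ih fun l => hasSum_sum fun x _ => h _

theorem const_mul (k : ℕ) (c : ℝ) (g : List α → ℝ) :
    sumLists k (fun l => c * g l) = c * sumLists k g := by
  induction k generalizing g with
  | zero => rfl
  | succ k ih =>
    simp only [sumLists]
    rw [← ih]
    exact congr fun l _ => (Finset.mul_sum _ _ _).symm

theorem tendsto {ι : Type*} {u : Filter ι} (k : ℕ) {g : ι → List α → ℝ} {g' : List α → ℝ}
    (h : ∀ l, Filter.Tendsto (fun i => g i l) u (nhds (g' l))) :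
    Filter.Tendsto (fun i => sumLists k (g i)) u (nhds (sumLists k g')) := by
  induction k generalizing g g' with
  | zero => exact h []
  | succ k ih => exact ih fun l => tendsto_finsetSum _ fun x _ => h _

end sumLists

/-- The product of the weights `φ l x` of all the steps from an initial segment `l` to `l ++ [x]`,
for a list given in reverse order. -/
def reversePathProd {α : Type*} (φ : List α → α → ℝ) : List α → ℝ
  | [] => 1
  | x :: l => reversePathProd φ l * φ l.reverse x

/-- The product of the weights `φ l x` of all the steps from an initial segment `l` to `l ++ [x]`. -/
def pathProd {α : Type*} (φ : List α → α → ℝ) (l : List α) : ℝ := reversePathProd φ l.reverse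

@[simp]
theorem pathProd_nil {α : Type*} (φ : List α → α → ℝ) : pathProd φ [] = 1 := rfl

@[simp]
theorem pathProd_concat {α : Type*} (φ : List α → α → ℝ) (l : List α) (x : α) :
    pathProd φ (l ++ [x]) = pathProd φ l * φ l x := by
  simp [pathProd, reversePathProd]

theorem pathProd_nonneg {α : Type*} {φ : List α → α → ℝ} (h : ∀ l x, 0 ≤ φ l x) (l : List α) :
    0 ≤ pathProd φ l := by
  induction l using List.reverseRecOn with
  | nil => simp
  | append_singleton l x ih =>
    rw [pathProd_concat]
    exact mul_nonneg ih (h l x)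

/-! ### Reach weights of strategies and indicators of not having stopped. -/

namespace BehavioralStrategy

variable {A S : Type*}

/-- The contribution of the player to the probability of his private history `l`. -/
noncomputable def reach (σ : BehavioralStrategy A S) : List (A × S) → ℝ :=
  pathProd fun l x => (σ l x.1).toReal

@[simp]
theorem reach_nil (σ : BehavioralStrategy A S) : reach σ [] = 1 := rfl

@[simp]
theorem reach_concat (σ : BehavioralStrategy A S) (l : List (A × S)) (x : A × S) :
    reach σ (l ++ [x]) = reach σ l * (σ l x.1).toReal := pathProd_concat _ l x

theorem reach_nonneg (σ : BehavioralStrategy A S) (l : List (A × S)) : 0 ≤ reach σ l :=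
  pathProd_nonneg (fun _ _ => ENNReal.toReal_nonneg) l

end BehavioralStrategy

namespace StopRule

variable {A S : Type*}

/-- If one history stops by `k`, the other agrees with it up to the stopping time and stops
simultaneously. Hence the arbitrary tail in `extend` never affects `alive`. -/
theorem lt_time_congr (s : StopRule A S) {k : ℕ} {h h' : ℕ → A × S} (hh : ∀ i < k, h i = h' i) :
    k < s.time h ↔ k < s.time h' := by
  rw [← not_le, ← not_le, not_iff_not]
  constructor
  · intro hk
    rwa [s.nonanticipating h h' fun i hi => (hh i (hi.trans_le hk)).symm]
  · intro hk
    rwa [s.nonanticipating h' h fun i hi => hh i (hi.trans_le hk)]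

variable [Nonempty (A × S)]

/-- An infinite private history that begins with `l`. -/
noncomputable def extend (l : List (A × S)) (i : ℕ) : A × S := l.getD i (Classical.arbitrary _)

/-- The indicator of not having stopped by the time at which the private history is `l`. -/
noncomputable def alive (s : StopRule A S) (l : List (A × S)) : ℝ :=
  if l.length < s.time (extend l) then 1 else 0

theorem alive_ofFn (s : StopRule A S) (h : ℕ → A × S) (k : ℕ) :
    s.alive (List.ofFn fun i : Fin k => h i) = if k < s.time h then 1 else 0 := by
  rw [alive, List.length_ofFn]
  refine if_congr (s.lt_time_congr fun i hi => ?_) rfl rfl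
  simp [extend, List.getD_eq_getElem?_getD, hi]

theorem alive_nonneg (s : StopRule A S) (l : List (A × S)) : 0 ≤ s.alive l := by
  rw [alive]; split_ifs <;> simp

theorem alive_le_one (s : StopRule A S) (l : List (A × S)) : s.alive l ≤ 1 := by
  rw [alive]; split_ifs <;> simp

theorem alive_concat_le (s : StopRule A S) (l : List (A × S)) (x : A × S) :
    s.alive (l ++ [x]) ≤ s.alive l := by
  by_cases h : (l ++ [x]).length < s.time (extend (l ++ [x]))
  · have h1 : l.length < s.time (extend l) := by
      rw [s.lt_time_congr (h' := extend (l ++ [x]))]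
      · exact lt_trans (by simp) h
      · intro i hi
        simp [extend, List.getD_eq_getElem?_getD, List.getElem?_append_left hi]
    rw [alive.eq_def s l, if_pos h1]
    exact s.alive_le_one _
  · rw [alive, if_neg h]
    exact s.alive_nonneg l

end StopRule

/-! ### The law of the play, and the truncated payoff as a finite sum. -/

namespace CumulativeGame

variable {A₁ A₂ S₁ S₂ : Type*} (G : CumulativeGame A₁ A₂ S₁ S₂)

theorem stageLaw_apply (σ₁ : BehavioralStrategy A₁ S₁) (σ₂ : BehavioralStrategy A₂ S₂)
    (l : List (Stage A₁ A₂ S₁ S₂)) (x : Stage A₁ A₂ S₁ S₂) :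
    G.stageLaw σ₁ σ₂ l x = σ₁ (l.map Stage.view₁) x.a₁ * (σ₂ (l.map Stage.view₂) x.a₂ *
      (G.p₁ (l.map Stage.actions ++ [x.actions]) x.s₁ *
        G.p₂ (l.map Stage.actions ++ [x.actions]) x.s₂)) := by
  simp only [stageLaw, PMF.bind_apply]
  rw [tsum_eq_single x.a₁, tsum_eq_single x.a₂, tsum_eq_single x.s₁, tsum_eq_single x.s₂]
  · simp [Stage.actions]
  · intro t ht
    simp [Stage.ext_iff, ht.symm]
  · intro t ht
    simp [Stage.ext_iff, ht.symm]
  · intro t ht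
    simp [Stage.ext_iff, ht.symm]
  · intro t ht
    simp [Stage.ext_iff, ht.symm]

/-- The contribution of the signals to the probability of the stages in a list. -/
noncomputable def chance : List (Stage A₁ A₂ S₁ S₂) → ℝ :=
  pathProd fun l x => (G.p₁ ((l ++ [x]).map Stage.actions) x.s₁).toReal *
    (G.p₂ ((l ++ [x]).map Stage.actions) x.s₂).toReal

theorem chance_nonneg (l : List (Stage A₁ A₂ S₁ S₂)) : 0 ≤ G.chance l :=
  pathProd_nonneg (fun _ _ => mul_nonneg ENNReal.toReal_nonneg ENNReal.toReal_nonneg) l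

/-- Each player acts independently on his own private history, so his factors collect into a weight
of that history alone. This factorization makes the payoff linear in each player's reach weights. -/
theorem pathProd_stageLaw (σ₁ : BehavioralStrategy A₁ S₁) (σ₂ : BehavioralStrategy A₂ S₂)
    (l : List (Stage A₁ A₂ S₁ S₂)) :
    pathProd (fun l x => (G.stageLaw σ₁ σ₂ l x).toReal) l =
      σ₁.reach (l.map Stage.view₁) * σ₂.reach (l.map Stage.view₂) * G.chance l := by
  induction l using List.reverseRecOn with
  | nil => simp [chance]
  | append_singleton l x ih =>
    rw [pathProd_concat, ih, chance, pathProd_concat, stageLaw_apply]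
    simp only [List.map_append, List.map_cons, List.map_nil, BehavioralStrategy.reach_concat,
      ENNReal.toReal_mul]
    simp only [Stage.view₁, Stage.view₂]
    ring

section Law

variable [Finite A₁] [Finite A₂] [Finite S₁] [Finite S₂]

instance (σ₁ : BehavioralStrategy A₁ S₁) (σ₂ : BehavioralStrategy A₂ S₂) :
    IsProbabilityMeasure (G.playLaw σ₁ σ₂) := by
  have : IsProbabilityMeasure (G.stageLaw σ₁ σ₂ []).toMeasure :=
    PMF.toMeasure.isProbabilityMeasure _
  unfold playLaw
  infer_instance

theorem integrable_comp_ofFn {α : Type*} [Finite α] [MeasurableSpace α] [MeasurableSingletonClass α]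
    (μ : Measure (ℕ → α)) [IsFiniteMeasure μ] (k : ℕ) (g : List α → ℝ) :
    Integrable (fun ω : ℕ → α => g (List.ofFn fun i : Fin k => ω i)) μ := by
  have hm : Measurable fun (ω : ℕ → α) (i : Fin k) => ω i :=
    measurable_pi_lambda _ fun _ => measurable_pi_apply _
  exact (Integrable.of_finite (f := fun v : Fin k → α => g (List.ofFn v))
    (μ := μ.map fun ω (i : Fin k) => ω i)).comp_measurable hm

/-- Conditioning on the first `k` stages. The case `k = 0` is separate because the first stage is
drawn from the initial law rather than from a kernel. -/
theorem integral_ofFn_succ [Fintype (Stage A₁ A₂ S₁ S₂)]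
    (σ₁ : BehavioralStrategy A₁ S₁) (σ₂ : BehavioralStrategy A₂ S₂) (k : ℕ)
    (g : List (Stage A₁ A₂ S₁ S₂) → ℝ) :
    ∫ ω, g (List.ofFn fun i : Fin (k + 1) => ω i) ∂(G.playLaw σ₁ σ₂) =
      ∫ ω, ∑ x, (G.stageLaw σ₁ σ₂ (List.ofFn fun i : Fin k => ω i) x).toReal *
        g (List.ofFn (fun i : Fin k => ω i) ++ [x]) ∂(G.playLaw σ₁ σ₂) := by
  have : IsProbabilityMeasure (G.stageLaw σ₁ σ₂ []).toMeasure :=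
    PMF.toMeasure.isProbabilityMeasure _
  cases k with
  | zero =>
    have h0 : (G.playLaw σ₁ σ₂).map (fun ω => ω 0) = (G.stageLaw σ₁ σ₂ []).toMeasure := by
      have h : (fun ω : ℕ → Stage A₁ A₂ S₁ S₂ => ω 0) =
          (fun v : (Π _ : Finset.Iic 0, Stage A₁ A₂ S₁ S₂) => v ⟨0, by simp⟩) ∘
            Preorder.frestrictLe 0 := rfl
      rw [h, ← Measure.map_map (by fun_prop) (by fun_prop), playLaw, Kernel.trajMeasure,
        Measure.map_comp _ _ (by fun_prop), Kernel.traj_map_frestrictLe, Kernel.partialTraj_self,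
        Measure.id_comp, Measure.map_map (by fun_prop) (by fun_prop)]
      exact Measure.map_id
    simp only [List.ofFn_zero, List.nil_append, integral_const, probReal_univ, one_smul,
      List.ofFn_succ, Fin.val_zero]
    have h1 := integral_map (μ := G.playLaw σ₁ σ₂) (φ := fun ω => ω 0)
      (measurable_pi_apply 0).aemeasurable
      (f := fun x => g [x]) (Measurable.of_discrete.aestronglyMeasurable)
    rw [← h1, h0, PMF.integral_eq_sum]
    rfl
  | succ a =>
    set F : (Π _ : Finset.Iic a, Stage A₁ A₂ S₁ S₂) → List (Stage A₁ A₂ S₁ S₂) := fun v =>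
      List.ofFn fun i : Fin (a + 1) => v ⟨i, Finset.mem_Iic.2 (Nat.lt_succ_iff.1 i.2)⟩ with hF
    have hlaw := Kernel.map_frestrictLe_trajMeasure_compProd_eq_map_trajMeasure
      (X := fun _ => Stage A₁ A₂ S₁ S₂) (μ₀ := (G.stageLaw σ₁ σ₂ []).toMeasure)
      (κ := G.stageKernel σ₁ σ₂) (a := a)
    change (G.playLaw σ₁ σ₂).map (Preorder.frestrictLe a) ⊗ₘ G.stageKernel σ₁ σ₂ a =
      (G.playLaw σ₁ σ₂).map fun x => (Preorder.frestrictLe a x, x (a + 1)) at hlaw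
    have h1 := integral_map (μ := G.playLaw σ₁ σ₂)
      (φ := fun x => (Preorder.frestrictLe (π := fun _ => Stage A₁ A₂ S₁ S₂) a x, x (a + 1)))
      (by fun_prop) (f := fun p => g (F p.1 ++ [p.2]))
      (Measurable.of_discrete.aestronglyMeasurable)
    rw [← hlaw, Measure.integral_compProd Integrable.of_finite,
      integral_map (by fun_prop) (Measurable.of_discrete.aestronglyMeasurable)] at h1
    calc _ = _ := by simp only [List.ofFn_succ_last (n := a + 1)]; rfl
      _ = _ := h1.symm
      _ = _ := integral_congr_ae (Filter.Eventually.of_forall fun ω =>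
        PMF.integral_eq_sum _ _)

theorem integral_ofFn [Fintype (Stage A₁ A₂ S₁ S₂)]
    (σ₁ : BehavioralStrategy A₁ S₁) (σ₂ : BehavioralStrategy A₂ S₂) (k : ℕ)
    (g : List (Stage A₁ A₂ S₁ S₂) → ℝ) :
    ∫ ω, g (List.ofFn fun i : Fin k => ω i) ∂(G.playLaw σ₁ σ₂) =
      sumLists k fun l => σ₁.reach (l.map Stage.view₁) * σ₂.reach (l.map Stage.view₂) *
        G.chance l * g l := by
  simp only [← pathProd_stageLaw]
  induction k generalizing g with
  | zero => simp [sumLists]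
  | succ k ih =>
    rw [integral_ofFn_succ, ih fun l => ∑ x, (G.stageLaw σ₁ σ₂ l x).toReal * g (l ++ [x])]
    refine sumLists.congr fun l _ => ?_
    rw [Finset.mul_sum]
    exact Finset.sum_congr rfl fun x _ => by simp only [pathProd_concat]; ring

/-- The expected payoff of the leavable game truncated at `n`, when the Maximizer uses a behavioral
strategy and continues beyond a private history `l` with probability `c l`. -/
noncomputable def planPay [Fintype (Stage A₁ A₂ S₁ S₂)] (n : ℕ) (σ₁ : BehavioralStrategy A₁ S₁)
    (c : List (A₁ × S₁) → ℝ) (σ₂ : BehavioralStrategy A₂ S₂) : ℝ :=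
  G.f [] + ∑ k ∈ Finset.range n, sumLists k fun l => ∑ x : Stage A₁ A₂ S₁ S₂,
    c (l.map Stage.view₁) * σ₁.reach (l.map Stage.view₁ ++ [x.view₁]) *
      (σ₂.reach ((l ++ [x]).map Stage.view₂) * G.chance (l ++ [x]) *
        G.f ((l ++ [x]).map Stage.actions))

theorem leavablePay_eq_planPay [Fintype (Stage A₁ A₂ S₁ S₂)] [Nonempty (A₁ × S₁)] {n : ℕ}
    (σ₁ : BehavioralStrategy A₁ S₁) (s : StopRule A₁ S₁) (hs : ∀ h, s.time h ≤ n)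
    (σ₂ : BehavioralStrategy A₂ S₂) :
    G.leavablePay (σ₁, s) σ₂ = G.planPay n σ₁ s.alive σ₂ := by
  -- The daily payoff after stage `k` is collected when `k < s.time`, which is decided by the first
  -- `k` stages: one fewer than the payoff sees, hence `dropLast`. The term `G.f []` is always
  -- collected.
  obtain ⟨g, hg⟩ : ∃ g : List (Stage A₁ A₂ S₁ S₂) → ℝ, ∀ l x, g (l ++ [x]) =
      s.alive (l.map Stage.view₁) * G.f ((l ++ [x]).map Stage.actions) :=
    ⟨fun l => s.alive (l.map Stage.view₁).dropLast * G.f (l.map Stage.actions), by simp⟩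
  have hcum : ∀ ω : ℕ → Stage A₁ A₂ S₁ S₂,
      G.cumulated (fun k => (ω k).actions) (s.time fun k => (ω k).view₁) =
        G.f [] + ∑ k ∈ Finset.range n, g (List.ofFn fun i : Fin (k + 1) => ω i) := by
    intro ω
    have hgω : ∀ k, g (List.ofFn fun i : Fin (k + 1) => ω i) =
        if k < s.time fun k => (ω k).view₁ then
          G.f (List.ofFn fun i : Fin (k + 1) => (ω i).actions) else 0 := by
      intro k
      have h := s.alive_ofFn (fun k => (ω k).view₁) k
      have h2 : (List.ofFn fun i : Fin (k + 1) => ω i).map Stage.actions =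
          List.ofFn fun i : Fin (k + 1) => (ω i).actions := by
        rw [List.map_ofFn]; rfl
      rw [← h2, List.ofFn_succ_last, hg, List.map_ofFn]
      refine (congrArg (· * _) h).trans ?_
      rw [ite_mul, one_mul, zero_mul]
    rw [cumulated, Finset.sum_range_succ', add_comm]
    congr 1
    rw [← Finset.sum_subset (Finset.range_subset_range.2 (hs fun k => (ω k).view₁))]
    · exact Finset.sum_congr rfl fun k hk => by rw [hgω, if_pos (Finset.mem_range.1 hk)]
    · exact fun k _ hk => by rw [hgω, if_neg (by simpa using hk)]
  simp only [leavablePay, hcum]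
  rw [integral_add (integrable_const _)
    (integrable_finsetSum _ fun k _ => integrable_comp_ofFn _ (k + 1) _),
    integral_finsetSum _ fun k _ => integrable_comp_ofFn _ (k + 1) _]
  simp only [integral_const, probReal_univ, one_smul, planPay]
  congr 1
  refine Finset.sum_congr rfl fun k _ => ?_
  rw [integral_ofFn]
  refine sumLists.congr fun l _ => Finset.sum_congr rfl fun x _ => ?_
  simp only [hg, List.map_append, List.map_cons, List.map_nil]
  ring

end Law

end CumulativeGame

/-! ### Realizing mixtures by behavioral strategies. -/

theorem PMF.hasSum_toReal {α : Type*} (p : PMF α) : HasSum (fun a => (p a).toReal) 1 := by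
  have h := ENNReal.hasSum_toReal (f := p) (by rw [p.tsum_coe]; simp)
  rwa [← ENNReal.tsum_toReal_eq p.apply_ne_top, p.tsum_coe, ENNReal.toReal_one] at h

theorem PMF.exists_toReal_eq {α : Type*} [Fintype α] (p : α → ℝ) (h0 : ∀ a, 0 ≤ p a)
    (h1 : ∑ a, p a = 1) : ∃ q : PMF α, ∀ a, (q a).toReal = p a := by
  refine ⟨PMF.ofFintype (fun a => ENNReal.ofReal (p a)) ?_, fun a => ?_⟩
  · rw [← ENNReal.ofReal_sum_of_nonneg fun a _ => h0 a, h1, ENNReal.ofReal_one]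
  · rw [PMF.ofFintype_apply, ENNReal.toReal_ofReal (h0 a)]

/-- Probabilities of continuing beyond a private history: they decrease along histories. -/
structure IsSurvival {α : Type*} (c : List α → ℝ) : Prop where
  nonneg : ∀ l, 0 ≤ c l
  le_one : ∀ l, c l ≤ 1
  concat_le : ∀ l x, c (l ++ [x]) ≤ c l

namespace BehavioralStrategy

variable {A S : Type*} {ι : Type*} [Fintype ι]

/-- At `l`, average the mixed actions `σ i l` with posterior weights proportional to `w i * (c i l *
reach (σ i) l)`. The product form leaves the action free where the total weight vanishes. -/
theorem exists_mixture [Finite A] [Nonempty A] (w : ι → ℝ) (hw : ∀ i, 0 ≤ w i)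
    (σ : ι → BehavioralStrategy A S) (c : ι → List (A × S) → ℝ) (hc : ∀ i l, 0 ≤ c i l) :
    ∃ τ : BehavioralStrategy A S, ∀ l a,
      (∑ i, w i * (c i l * reach (σ i) l)) * (τ l a).toReal =
        ∑ i, w i * (c i l * (reach (σ i) l * (σ i l a).toReal)) := by
  have := Fintype.ofFinite A
  have h : ∀ l, ∃ q : PMF A, ∀ a, (∑ i, w i * (c i l * reach (σ i) l)) * (q a).toReal =
      ∑ i, w i * (c i l * (reach (σ i) l * (σ i l a).toReal)) := by
    intro l
    have hterm : ∀ i, 0 ≤ w i * (c i l * reach (σ i) l) := fun i =>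
      mul_nonneg (hw i) (mul_nonneg (hc i l) (reach_nonneg _ _))
    rcases (Finset.sum_nonneg fun i _ => hterm i :
      0 ≤ ∑ i, w i * (c i l * reach (σ i) l)).eq_or_lt with h | h
    · refine ⟨PMF.pure (Classical.arbitrary A), fun a => ?_⟩
      rw [← h, zero_mul, Finset.sum_eq_zero fun i hi => ?_]
      have := (Finset.sum_eq_zero_iff_of_nonneg fun i _ => hterm i).1 h.symm i hi
      rw [← mul_assoc (c i l), ← mul_assoc (w i), this, zero_mul]
    · obtain ⟨q, hq⟩ := PMF.exists_toReal_eq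
        (fun a => (∑ i, w i * (c i l * (reach (σ i) l * (σ i l a).toReal))) /
          ∑ i, w i * (c i l * reach (σ i) l))
        (fun a => div_nonneg (Finset.sum_nonneg fun i _ => mul_nonneg (hw i) (mul_nonneg (hc i l)
          (mul_nonneg (reach_nonneg _ _) ENNReal.toReal_nonneg))) h.le) (by
          rw [← Finset.sum_div, div_eq_one_iff_eq h.ne', Finset.sum_comm]
          refine Finset.sum_congr rfl fun i _ => ?_
          have h1 := (PMF.hasSum_toReal (σ i l)).tsum_eq
          rw [tsum_fintype] at h1
          rw [← Finset.mul_sum, ← Finset.mul_sum, ← Finset.mul_sum, h1, mul_one])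
      exact ⟨q, fun a => by rw [hq, mul_div_cancel₀ _ h.ne']⟩
  choose τ hτ using h
  exact ⟨τ, hτ⟩

/-- Finite mixtures of behavioral strategies are realized by behavioral strategies. -/
theorem exists_reach_eq_sum [Finite A] [Nonempty A] (w : ι → ℝ) (hw : ∀ i, 0 ≤ w i)
    (hw1 : ∑ i, w i = 1) (σ : ι → BehavioralStrategy A S) :
    ∃ τ : BehavioralStrategy A S, ∀ l, reach τ l = ∑ i, w i * reach (σ i) l := by
  obtain ⟨τ, hτ⟩ := exists_mixture w hw σ (fun _ _ => 1) fun _ _ => zero_le_one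
  simp only [one_mul] at hτ
  refine ⟨τ, fun l => ?_⟩
  induction l using List.reverseRecOn with
  | nil => simp [hw1]
  | append_singleton l x ih => simp only [reach_concat, ih, hτ]

/-- Finite mixtures of behavioral strategies with probabilities of continuing are realized by a
behavioral strategy with probabilities of continuing. -/
theorem exists_isSurvival_mul_reach_eq_sum [Finite A] [Nonempty A] (w : ι → ℝ)
    (hw : ∀ i, 0 ≤ w i) (hw1 : ∑ i, w i = 1) (σ : ι → BehavioralStrategy A S)
    (c : ι → List (A × S) → ℝ) (hc : ∀ i, IsSurvival (c i)) :
    ∃ (τ : BehavioralStrategy A S) (d : List (A × S) → ℝ), IsSurvival d ∧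
      ∀ l x, d l * reach τ (l ++ [x]) = ∑ i, w i * (c i l * reach (σ i) (l ++ [x])) := by
  obtain ⟨τ, hτ⟩ := exists_mixture w hw σ c fun i => (hc i).nonneg
  -- The mixture's joint weight of reaching `l` and continuing. Dividing by `reach τ` leaves the
  -- conditional probability of continuing; `hzero` shows that nothing is lost where the divisor is
  -- zero.
  set q : List (A × S) → ℝ := fun l => ∑ i, w i * (c i l * reach (σ i) l) with hq
  have hq0 : ∀ l, 0 ≤ q l := fun l => Finset.sum_nonneg fun i _ =>
    mul_nonneg (hw i) (mul_nonneg ((hc i).nonneg l) (reach_nonneg _ _))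
  have hqle : ∀ l x, q (l ++ [x]) ≤ q l * (τ l x.1).toReal := by
    intro l x
    rw [hτ]
    refine Finset.sum_le_sum fun i _ => mul_le_mul_of_nonneg_left ?_ (hw i)
    rw [reach_concat]
    exact mul_le_mul_of_nonneg_right ((hc i).concat_le l x)
      (mul_nonneg (reach_nonneg _ _) ENNReal.toReal_nonneg)
  have hzero : ∀ l, reach τ l = 0 → q l = 0 := by
    intro l
    induction l using List.reverseRecOn with
    | nil => simp
    | append_singleton l x ih =>
      intro h
      refine le_antisymm ((hqle l x).trans ?_) (hq0 _)
      rw [reach_concat, mul_eq_zero] at h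
      rcases h with h | h
      · rw [ih h, zero_mul]
      · rw [h, mul_zero]
  have hconcat : ∀ l x, q (l ++ [x]) / reach τ (l ++ [x]) ≤ q l / reach τ l := by
    intro l x
    rw [reach_concat]
    -- At zero divisors the quotients are `0` by convention, so the inequality survives there.
    rcases (reach_nonneg τ l).eq_or_lt with h | h
    · simp [← h]
    rcases (ENNReal.toReal_nonneg : 0 ≤ (τ l x.1).toReal).eq_or_lt with h' | h'
    · rw [← h', mul_zero, div_zero]
      exact div_nonneg (hq0 l) h.le
    · rw [div_le_div_iff₀ (mul_pos h h') h]
      calc q (l ++ [x]) * reach τ l ≤ q l * (τ l x.1).toReal * reach τ l :=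
            mul_le_mul_of_nonneg_right (hqle l x) h.le
        _ = _ := by ring
  refine ⟨τ, fun l => q l / reach τ l, ⟨fun l => div_nonneg (hq0 l) (reach_nonneg _ _), ?_,
    hconcat⟩, fun l x => ?_⟩
  · intro l
    induction l using List.reverseRecOn with
    | nil =>
      simp only [hq, reach_nil, mul_one, div_one]
      calc ∑ i, w i * c i [] ≤ ∑ i, w i := Finset.sum_le_sum fun i _ =>
            mul_le_of_le_one_right (hw i) ((hc i).le_one [])
        _ = 1 := hw1
    | append_singleton l x ih => exact (hconcat l x).trans ih
  · have h : q l / reach τ l * reach τ l = q l := div_mul_cancel_of_imp (hzero l)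
    simp only [reach_concat]
    rw [← mul_assoc, h, hτ]

end BehavioralStrategy

/-! ### Random stop rules with prescribed probabilities of continuing. -/

namespace StopRule

variable {A S : Type*}

open Classical in
/-- Stop at the first private history that is not in `b`, and at `n` at the latest. -/
noncomputable def stopOutside (n : ℕ) (b : Set (List (A × S))) : StopRule A S where
  time h := Nat.find (p := fun k => n ≤ k ∨ List.ofFn (fun i : Fin k => h i) ∉ b) ⟨n, Or.inl le_rfl⟩
  nonanticipating h h' hh := by
    have hk : ∀ m ≤ Nat.find (p := fun k => n ≤ k ∨ List.ofFn (fun i : Fin k => h i) ∉ b)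
        ⟨n, Or.inl le_rfl⟩,
        List.ofFn (fun i : Fin m => h' i) = List.ofFn fun i : Fin m => h i := fun m hm =>
      congrArg List.ofFn (funext fun i => hh i (i.2.trans_le hm))
    rw [Nat.find_eq_iff]
    refine ⟨?_, fun m hm => ?_⟩
    · rw [hk _ le_rfl]
      exact Nat.find_spec (p := fun k => n ≤ k ∨ List.ofFn (fun i : Fin k => h i) ∉ b) _
    · rw [hk _ hm.le]
      exact Nat.find_min (p := fun k => n ≤ k ∨ List.ofFn (fun i : Fin k => h i) ∉ b) _ hm

theorem stopOutside_time_le (n : ℕ) (b : Set (List (A × S))) (h : ℕ → A × S) :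
    (stopOutside n b).time h ≤ n := by
  classical exact Nat.find_min' _ (Or.inl le_rfl)

theorem lt_stopOutside_time_iff {n : ℕ} {b : Set (List (A × S))} {h : ℕ → A × S} {k : ℕ} :
    k < (stopOutside n b).time h ↔
      ∀ m ≤ k, m < n ∧ List.ofFn (fun i : Fin m => h i) ∈ b := by
  classical
  rw [stopOutside, Nat.lt_find_iff]
  simp

/-- The constant stop rule. -/
def const (A S : Type*) (n : ℕ) : StopRule A S := ⟨fun _ => n, fun _ _ _ => rfl⟩

variable [Nonempty (A × S)]

theorem ofFn_extend {l : List (A × S)} {m : ℕ} (hm : m ≤ l.length) :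
    List.ofFn (fun i : Fin m => extend l i) = l.take m := by
  refine List.ext_getElem (by simp [hm]) fun i h1 h2 => ?_
  simp only [List.length_ofFn] at h1
  simp [extend, List.getD_eq_getElem?_getD, List.getElem?_eq_getElem (h1.trans_le hm)]

/-- The probability that a random stop rule continues beyond a private history. -/
noncomputable def survival (P : PMF (StopRule A S)) (l : List (A × S)) : ℝ :=
  ∑' s, (P s).toReal * s.alive l

theorem hasSum_survival (P : PMF (StopRule A S)) (l : List (A × S)) :
    HasSum (fun s => (P s).toReal * s.alive l) (survival P l) :=
  (Summable.of_nonneg_of_le (fun s => mul_nonneg ENNReal.toReal_nonneg (s.alive_nonneg l))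
    (fun s => mul_le_of_le_one_right ENNReal.toReal_nonneg (s.alive_le_one l))
    P.hasSum_toReal.summable).hasSum

theorem isSurvival_survival (P : PMF (StopRule A S)) : IsSurvival (survival P) where
  nonneg l := tsum_nonneg fun s => mul_nonneg ENNReal.toReal_nonneg (s.alive_nonneg l)
  le_one l := hasSum_le (fun s => mul_le_of_le_one_right ENNReal.toReal_nonneg (s.alive_le_one l))
    (hasSum_survival P l) P.hasSum_toReal
  concat_le l x := hasSum_le (fun s => mul_le_mul_of_nonneg_left (s.alive_concat_le l x)
    ENNReal.toReal_nonneg) (hasSum_survival P _) (hasSum_survival P l)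

theorem survival_eq_toReal (P : PMF (StopRule A S)) (l : List (A × S)) :
    survival P l = (P.toOuterMeasure {s | l.length < s.time (extend l)}).toReal := by
  rw [PMF.toOuterMeasure_apply, ENNReal.tsum_toReal_eq]
  · refine tsum_congr fun s => ?_
    by_cases h : l.length < s.time (extend l) <;> simp [alive, h]
  · intro s
    exact ne_top_of_le_ne_top (P.apply_ne_top s) (Set.indicator_le_self _ _ s)

/-- Every system of probabilities of continuing is realized, up to time `n`, by a random stop rule:
stop as soon as the probability of continuing is below a uniformly distributed threshold. -/
theorem exists_survival_eq [Finite A] [Finite S] (n : ℕ) {c : List (A × S) → ℝ}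
    (hc : IsSurvival c) :
    ∃ P : PMF (StopRule A S), (∀ s ∈ P.support, ∀ h, s.time h ≤ n) ∧
      ∀ l, l.length < n → survival P l = c l := by
  classical
  -- Only these finitely many histories matter, so the uniform threshold acts through a finite
  -- Boolean pattern, and its law becomes a `PMF` on stop rules.
  set L := {l : List (A × S) // l.length < n} with hL
  have : Finite L := (List.finite_length_lt (A × S) n).to_subtype
  set μ : Measure ℝ := volume.restrict (Set.Ioc 0 1) with hμ
  have : IsProbabilityMeasure μ := ⟨by simp [hμ]⟩
  set φ : ℝ → L → Bool := fun u l => decide (u ≤ c l) with hφ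
  have hφm : Measurable φ := by
    refine measurable_pi_lambda _ fun l => measurable_to_bool ?_
    have : (fun u => φ u l) ⁻¹' {true} = Set.Iic (c l) := by ext u; simp [hφ]
    rw [this]
    exact measurableSet_Iic
  have := Measure.isProbabilityMeasure_map (μ := μ) hφm.aemeasurable
  set ψ : (L → Bool) → StopRule A S := fun b =>
    stopOutside n {l | ∃ h : l.length < n, b ⟨l, h⟩ = true} with hψ
  refine ⟨(μ.map φ).toPMF.map ψ, ?_, fun l hl => ?_⟩
  · intro s hs h
    rw [PMF.mem_support_map_iff] at hs
    obtain ⟨b, -, rfl⟩ := hs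
    exact stopOutside_time_le _ _ _
  -- A threshold at most `c l` also passes at every prefix of `l`, so continuing beyond `l` is
  -- exactly the event `u ≤ c l`.
  · have hprefix : ∀ m ≤ l.length, c l ≤ c (l.take m) := by
      intro m hm
      clear hl
      induction l using List.reverseRecOn with
      | nil => simp
      | append_singleton l x ih =>
        rcases hm.eq_or_lt with h | h
        · rw [h, List.take_length]
        · simp only [List.length_append, List.length_singleton] at h
          rw [List.take_append_of_le_length (by omega)]
          exact (hc.concat_le l x).trans (ih (by omega))
    have hset : φ ⁻¹' (ψ ⁻¹' {s | l.length < s.time (extend l)}) = Set.Iic (c l) := by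
      ext u
      simp only [hψ, hφ, Set.mem_preimage, Set.mem_ofPred_eq, Set.mem_Iic, lt_stopOutside_time_iff,
        decide_eq_true_eq]
      constructor
      · intro h
        obtain ⟨-, -, h⟩ := h l.length le_rfl
        rwa [ofFn_extend le_rfl, List.take_length] at h
      · intro h m hm
        refine ⟨hm.trans_lt hl, by simpa using hm.trans_lt hl, ?_⟩
        rw [ofFn_extend hm]
        exact h.trans (hprefix m hm)
    rw [survival_eq_toReal, PMF.toOuterMeasure_map_apply,
      ← PMF.toMeasure_apply_eq_toOuterMeasure, Measure.toPMF_toMeasure,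
      Measure.map_apply hφm (Set.toFinite _).measurableSet, hset, hμ,
      Measure.restrict_apply measurableSet_Iic, Set.Iic_inter_Ioc_of_le (hc.le_one l),
      Real.volume_Ioc, sub_zero, ENNReal.toReal_ofReal (hc.nonneg l)]

end StopRule

/-! ### Monotonicity, linearity and continuity of the truncated payoff. -/

namespace CumulativeGame

variable {A₁ A₂ S₁ S₂ : Type*} (G : CumulativeGame A₁ A₂ S₁ S₂)
  [Fintype (Stage A₁ A₂ S₁ S₂)]

theorem planPay_congr {n : ℕ} (σ₁ : BehavioralStrategy A₁ S₁) {c c' : List (A₁ × S₁) → ℝ}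
    (h : ∀ l, l.length < n → c l = c' l) (σ₂ : BehavioralStrategy A₂ S₂) :
    G.planPay n σ₁ c σ₂ = G.planPay n σ₁ c' σ₂ := by
  simp only [planPay]
  congr 1
  refine Finset.sum_congr rfl fun k hk => sumLists.congr fun l hl =>
    Finset.sum_congr rfl fun x _ => ?_
  rw [h]
  simpa [hl] using hk

theorem planPay_mono {n : ℕ} (hf : ∀ h, 0 ≤ G.f h) (σ₁ : BehavioralStrategy A₁ S₁)
    {c c' : List (A₁ × S₁) → ℝ}
    (h : ∀ l, l.length < n → c l ≤ c' l) (σ₂ : BehavioralStrategy A₂ S₂) :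
    G.planPay n σ₁ c σ₂ ≤ G.planPay n σ₁ c' σ₂ := by
  simp only [planPay]
  refine add_le_add le_rfl (Finset.sum_le_sum fun k hk => sumLists.mono fun l hl =>
    Finset.sum_le_sum fun x _ => mul_le_mul_of_nonneg_right (mul_le_mul_of_nonneg_right
      (h _ (by simpa [hl] using hk)) (σ₁.reach_nonneg _)) (mul_nonneg (mul_nonneg
        (σ₂.reach_nonneg _) (G.chance_nonneg _)) (hf _)))

/-- Serves mixtures of either player and, with infinite `ι`, random stop rules. Total weight `1` is
needed for the constant term `G.f []`. -/
theorem hasSum_planPay {ι : Type*} (n : ℕ) {w : ι → ℝ} (hw : HasSum w 1)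
    {σ₁ : ι → BehavioralStrategy A₁ S₁} {c : ι → List (A₁ × S₁) → ℝ}
    {σ₂ : ι → BehavioralStrategy A₂ S₂} {τ₁ : BehavioralStrategy A₁ S₁}
    {d : List (A₁ × S₁) → ℝ} {τ₂ : BehavioralStrategy A₂ S₂}
    (h : ∀ l x m, HasSum (fun i => w i * (c i l * (σ₁ i).reach (l ++ [x]) * (σ₂ i).reach m))
      (d l * τ₁.reach (l ++ [x]) * τ₂.reach m)) :
    HasSum (fun i => w i * G.planPay n (σ₁ i) (c i) (σ₂ i)) (G.planPay n τ₁ d τ₂) := by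
  have hterm : ∀ i, w i * G.planPay n (σ₁ i) (c i) (σ₂ i) =
      w i * G.f [] + ∑ k ∈ Finset.range n, sumLists k fun l => ∑ x : Stage A₁ A₂ S₁ S₂,
        w i * (c i (l.map Stage.view₁) * (σ₁ i).reach (l.map Stage.view₁ ++ [x.view₁]) *
          (σ₂ i).reach ((l ++ [x]).map Stage.view₂)) * (G.chance (l ++ [x]) *
            G.f ((l ++ [x]).map Stage.actions)) := by
    intro i
    rw [planPay, mul_add, Finset.mul_sum]
    congr 1
    refine Finset.sum_congr rfl fun k _ => ?_
    rw [← sumLists.const_mul]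
    refine sumLists.congr fun l _ => ?_
    rw [Finset.mul_sum]
    exact Finset.sum_congr rfl fun x _ => by ring
  have hlim : G.planPay n τ₁ d τ₂ = 1 * G.f [] + ∑ k ∈ Finset.range n, sumLists k fun l =>
      ∑ x : Stage A₁ A₂ S₁ S₂,
        d (l.map Stage.view₁) * τ₁.reach (l.map Stage.view₁ ++ [x.view₁]) *
          τ₂.reach ((l ++ [x]).map Stage.view₂) * (G.chance (l ++ [x]) *
            G.f ((l ++ [x]).map Stage.actions)) := by
    rw [planPay, one_mul]
    congr 1
    refine Finset.sum_congr rfl fun k _ => sumLists.congr fun l _ =>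
      Finset.sum_congr rfl fun x _ => by ring
  simp only [hterm, hlim]
  exact (hw.mul_right _).add (hasSum_sum fun k _ => sumLists.hasSum k fun l =>
    hasSum_sum fun x _ => (h _ _ _).mul_right _)

/-- Truncation leaves finitely many terms, each polynomial in the probabilities `σ₂ l a`. -/
theorem tendsto_planPay {ι : Type*} {u : Filter ι} (n : ℕ) (σ₁ : BehavioralStrategy A₁ S₁)
    (c : List (A₁ × S₁) → ℝ) {σ₂ : ι → BehavioralStrategy A₂ S₂} {τ₂ : BehavioralStrategy A₂ S₂}
    (h : ∀ l a, Filter.Tendsto (fun i => (σ₂ i l a).toReal) u (nhds (τ₂ l a).toReal)) :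
    Filter.Tendsto (fun i => G.planPay n σ₁ c (σ₂ i)) u (nhds (G.planPay n σ₁ c τ₂)) := by
  have hreach : ∀ l, Filter.Tendsto (fun i => (σ₂ i).reach l) u (nhds (τ₂.reach l)) := by
    intro l
    induction l using List.reverseRecOn with
    | nil => exact tendsto_const_nhds
    | append_singleton l x ih =>
      simp only [BehavioralStrategy.reach_concat]
      exact ih.mul (h l x.1)
  simp only [planPay]
  exact (tendsto_finsetSum _ fun k _ => sumLists.tendsto k fun l => tendsto_finsetSum _ fun x _ =>
    (((hreach _).mul_const _).mul_const _).const_mul _).const_add _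

end CumulativeGame

/-! ### Compactness of strategies and boundedness of stop rules. -/

/-- Behavioral strategies have pointwise limits along ultrafilters. -/
theorem BehavioralStrategy.exists_tendsto {A S ι : Type*} [Finite A] (U : Ultrafilter ι)
    (σ : ι → BehavioralStrategy A S) :
    ∃ τ : BehavioralStrategy A S, ∀ l a,
      Filter.Tendsto (fun i => (σ i l a).toReal) U (nhds (τ l a).toReal) := by
  have := Fintype.ofFinite A
  have hlim : ∀ l a, ∃ t ∈ Set.Icc (0 : ℝ) 1,
      Filter.Tendsto (fun i => (σ i l a).toReal) U (nhds t) := fun l a =>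
    isCompact_Icc.ultrafilter_le_nhds (U.map fun i => (σ i l a).toReal) (by
      rw [Filter.le_principal_iff]
      exact Filter.mem_map.2 (Filter.Eventually.of_forall fun i => ⟨ENNReal.toReal_nonneg,
        ENNReal.toReal_le_of_le_ofReal zero_le_one (by
          rw [ENNReal.ofReal_one]; exact (σ i l).coe_le_one a)⟩))
  choose t ht htend using hlim
  have hsum : ∀ l, ∑ a, t l a = 1 := fun l => by
    refine tendsto_nhds_unique (tendsto_finsetSum _ fun a _ => htend l a) ?_
    have : ∀ i, ∑ a, (σ i l a).toReal = 1 := fun i => by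
      rw [← tsum_fintype (L := .unconditional _)]
      exact (PMF.hasSum_toReal (σ i l)).tsum_eq
    simp only [this]
    exact tendsto_const_nhds
  choose τ hτ using fun l => PMF.exists_toReal_eq (t l) (fun a => (ht l a).1) (hsum l)
  exact ⟨τ, fun l a => by rw [hτ]; exact htend l a⟩

/-- With finitely many actions and signals, a stop rule is bounded. -/
theorem StopRule.exists_time_le {A S : Type*} [Finite A] [Finite S] (s : StopRule A S) :
    ∃ n, ∀ h, s.time h ≤ n := by
  let tA : TopologicalSpace (A × S) := ⊥
  have : DiscreteTopology (A × S) := ⟨rfl⟩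
  -- Non-anticipation is local constancy on infinite histories, a compact space as a product of
  -- finite discrete ones.
  have hcont : Continuous s.time := by
    refine (IsLocallyConstant.iff_eventually_eq _).2 (fun h => ?_) |>.continuous
    have : ∀ᶠ h' in nhds h, ∀ k ∈ Finset.range (s.time h), h' k = h k :=
      (Filter.eventually_all_finset _).2 fun k _ =>
        (continuous_apply (A := fun _ : ℕ => A × S) k).continuousAt.eventually_mem
          ((isOpen_discrete {h k}).mem_nhds rfl)
    filter_upwards [this] with h' hh'
    exact s.nonanticipating h h' fun k hk => hh' k (Finset.mem_range.2 hk)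
  obtain ⟨n, hn⟩ := (isCompact_range hcont).bddAbove
  exact ⟨n, fun h => hn ⟨h, rfl⟩⟩

/-! ### The minimax hypotheses for random stop rules. -/

namespace CumulativeGame

variable {A₁ A₂ S₁ S₂ : Type*} (G : CumulativeGame A₁ A₂ S₁ S₂)
  [Finite A₁] [Finite A₂] [Finite S₁] [Finite S₂]

theorem abs_leavablePay_le {B : ℝ} (hB : ∀ (h : ℕ → A₁ × A₂) (n : ℕ), |G.cumulated h n| < B)
    (x : BehavioralStrategy A₁ S₁ × StopRule A₁ S₁) (σ₂ : BehavioralStrategy A₂ S₂) :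
    |G.leavablePay x σ₂| ≤ B := by
  have := norm_integral_le_of_norm_le_const (μ := G.playLaw x.1 σ₂)
    (f := fun ω => G.cumulated (fun k => (ω k).actions) (x.2.time fun k => (ω k).view₁)) (C := B)
    (Filter.Eventually.of_forall fun ω : ℕ → Stage A₁ A₂ S₁ S₂ =>
      (hB (fun k => (ω k).actions) (x.2.time fun k => (ω k).view₁)).le)
  simpa [leavablePay] using this

theorem summable_mul_leavablePay (hG : G.LeavableBounded) (σ₁ : BehavioralStrategy A₁ S₁)
    (P : PMF (StopRule A₁ S₁)) (σ₂ : BehavioralStrategy A₂ S₂) :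
    Summable fun s => (P s).toReal * G.leavablePay (σ₁, s) σ₂ := by
  obtain ⟨B, hB⟩ := hG
  refine Summable.of_norm_bounded (P.hasSum_toReal.summable.mul_right B) fun s => ?_
  rw [norm_mul, Real.norm_of_nonneg ENNReal.toReal_nonneg]
  exact mul_le_mul_of_nonneg_left (G.abs_leavablePay_le hB _ _) ENNReal.toReal_nonneg

theorem randomizedLeavablePay_le (hG : G.LeavableBounded) {σ₁ : BehavioralStrategy A₁ S₁}
    {P : PMF (StopRule A₁ S₁)} {σ₂ : BehavioralStrategy A₂ S₂} {c : ℝ}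
    (h : ∀ s, G.leavablePay (σ₁, s) σ₂ ≤ c) : G.randomizedLeavablePay (σ₁, P) σ₂ ≤ c := by
  have := hasSum_le (fun s => mul_le_mul_of_nonneg_left (h s) ENNReal.toReal_nonneg)
    (G.summable_mul_leavablePay hG σ₁ P σ₂).hasSum (P.hasSum_toReal.mul_right c)
  rwa [one_mul] at this

theorem abs_randomizedLeavablePay_le {B : ℝ}
    (hB : ∀ (h : ℕ → A₁ × A₂) (n : ℕ), |G.cumulated h n| < B)
    (x : BehavioralStrategy A₁ S₁ × PMF (StopRule A₁ S₁)) (σ₂ : BehavioralStrategy A₂ S₂) :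
    |G.randomizedLeavablePay x σ₂| ≤ B := by
  refine abs_le.2 ⟨?_, G.randomizedLeavablePay_le ⟨B, hB⟩ fun s =>
    (abs_le.1 (G.abs_leavablePay_le hB _ _)).2⟩
  have := hasSum_le (fun s => mul_le_mul_of_nonneg_left
    (abs_le.1 (G.abs_leavablePay_le hB (x.1, s) σ₂)).1 ENNReal.toReal_nonneg)
    (x.2.hasSum_toReal.mul_right (-B)) (G.summable_mul_leavablePay ⟨B, hB⟩ x.1 x.2 σ₂).hasSum
  rwa [one_mul] at this

theorem randomizedLeavablePay_pure (σ₁ : BehavioralStrategy A₁ S₁) (s : StopRule A₁ S₁)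
    (σ₂ : BehavioralStrategy A₂ S₂) :
    G.randomizedLeavablePay (σ₁, PMF.pure s) σ₂ = G.leavablePay (σ₁, s) σ₂ := by
  rw [randomizedLeavablePay, tsum_eq_single s]
  · simp
  · intro t ht
    simp [PMF.pure_apply, ht]

theorem pure_mem_randomlyStopsBy {A S : Type*} {n : ℕ}
    {x : BehavioralStrategy A S × StopRule A S} (hx : x ∈ StopsBy A S n) :
    (x.1, PMF.pure x.2) ∈ RandomlyStopsBy A S n := by
  intro s hs
  rw [PMF.support_pure, Set.mem_singleton_iff] at hs
  rw [hs]
  exact hx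

theorem randomizedLeavablePay_eq_planPay [Fintype (Stage A₁ A₂ S₁ S₂)] [Nonempty (A₁ × S₁)]
    {n : ℕ} {x : BehavioralStrategy A₁ S₁ × PMF (StopRule A₁ S₁)}
    (hx : x ∈ RandomlyStopsBy A₁ S₁ n) (σ₂ : BehavioralStrategy A₂ S₂) :
    G.randomizedLeavablePay x σ₂ = G.planPay n x.1 (StopRule.survival x.2) σ₂ := by
  have h := G.hasSum_planPay n x.2.hasSum_toReal (σ₁ := fun _ => x.1) (c := fun s => s.alive)
    (σ₂ := fun _ => σ₂) (τ₁ := x.1) (d := StopRule.survival x.2) (τ₂ := σ₂) fun l y m => by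
      simp only [← mul_assoc]
      exact ((StopRule.hasSum_survival x.2 l).mul_right _).mul_right _
  rw [← h.tsum_eq, randomizedLeavablePay]
  refine tsum_congr fun s => ?_
  by_cases hs : s ∈ x.2.support
  · rw [G.leavablePay_eq_planPay x.1 s (hx s hs)]
  · rw [PMF.mem_support_iff, not_not] at hs
    simp [hs]

/-- A limit, along an ultrafilter finer than `atTop`, of strategies meeting finite subfamilies. Each
constraint holds eventually and passes to the limit, since its stop rules share a bound `n`. -/
theorem compactMin_randomizedLeavablePay [Nonempty (A₁ × S₁)] :
    ZeroSum.CompactMin G.randomizedLeavablePay (⋃ n, RandomlyStopsBy A₁ S₁ n) := by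
  classical
  have := Fintype.ofFinite (Stage A₁ A₂ S₁ S₂)
  intro E hE hF
  have h : ∀ F : Finset E, ∃ y, ∀ p ∈ F, G.randomizedLeavablePay p.1.1 y ≤ p.1.2 := by
    intro F
    obtain ⟨y, hy⟩ := hF (F.map (Function.Embedding.subtype _)) (by
      intro p hp
      obtain ⟨q, -, rfl⟩ := Finset.mem_map.1 hp
      exact q.2)
    exact ⟨y, fun p hp => hy _ (Finset.mem_map_of_mem _ hp)⟩
  choose σ hσ using h
  obtain ⟨τ, hτ⟩ := BehavioralStrategy.exists_tendsto
    (Ultrafilter.of (Filter.atTop : Filter (Finset E))) σ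
  refine ⟨τ, fun p hp => ?_⟩
  obtain ⟨n, hn⟩ := Set.mem_iUnion.1 (hE p hp)
  have hlim := G.tendsto_planPay n p.1.1 (StopRule.survival p.1.2) hτ
  simp only [← G.randomizedLeavablePay_eq_planPay hn] at hlim
  refine le_of_tendsto hlim (Ultrafilter.of_le _ ?_)
  filter_upwards [Filter.eventually_ge_atTop ({⟨p, hp⟩} : Finset E)] with F hF
  exact hσ F ⟨p, hp⟩ (hF (Finset.mem_singleton_self _))

/-- Here randomization is essential: mixing strategies with their stop rules leaves fractional
probabilities of continuing, which a random rule bounded by `n` realizes exactly. -/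
theorem concaveMax_randomizedLeavablePay [Nonempty A₁] [Nonempty (A₁ × S₁)] (n : ℕ) :
    ZeroSum.ConcaveMax G.randomizedLeavablePay (RandomlyStopsBy A₁ S₁ n) := by
  have := Fintype.ofFinite (Stage A₁ A₂ S₁ S₂)
  intro F w hF hw hw1
  have hw1' : ∑ i : F, w i = 1 := by rw [Finset.sum_coe_sort F w, hw1]
  obtain ⟨τ, d, hd, h⟩ := BehavioralStrategy.exists_isSurvival_mul_reach_eq_sum
    (fun i : F => w i) (fun i => hw i i.2) hw1' (fun i => i.1.1)
    (fun i => StopRule.survival i.1.2) fun i => StopRule.isSurvival_survival _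
  obtain ⟨P, hP, hPd⟩ := StopRule.exists_survival_eq n hd
  refine ⟨(τ, P), hP, fun σ₂ => le_of_eq ?_⟩
  rw [G.randomizedLeavablePay_eq_planPay (x := (τ, P)) hP, G.planPay_congr _ hPd]
  have hsum := G.hasSum_planPay n (w := fun i : F => w i) (hw1' ▸ hasSum_fintype _)
    (σ₁ := fun i => i.1.1) (c := fun i => StopRule.survival i.1.2) (σ₂ := fun _ => σ₂)
    (τ₁ := τ) (d := d) (τ₂ := σ₂) fun l x m => by
      rw [h, Finset.sum_mul]
      simp only [← mul_assoc]
      exact hasSum_fintype _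
  rw [hsum.unique (hasSum_fintype _), ← Finset.sum_coe_sort F]
  exact Finset.sum_congr rfl fun i _ => by rw [G.randomizedLeavablePay_eq_planPay (hF i.2)]

theorem convexMin_randomizedLeavablePay [Nonempty A₂] [Nonempty (A₁ × S₁)] (n : ℕ) :
    ZeroSum.ConvexMin G.randomizedLeavablePay (RandomlyStopsBy A₁ S₁ n) := by
  have := Fintype.ofFinite (Stage A₁ A₂ S₁ S₂)
  intro σ σ' a b ha hb hab
  have hw : ∀ i : Bool, 0 ≤ cond i a b := fun i => by cases i <;> assumption
  have hw1 : ∑ i : Bool, cond i a b = 1 := by simpa using hab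
  obtain ⟨τ, hτ⟩ := BehavioralStrategy.exists_reach_eq_sum (fun i : Bool => cond i a b) hw hw1
    fun i => cond i σ σ'
  refine ⟨τ, fun x hx => le_of_eq ?_⟩
  simp only [G.randomizedLeavablePay_eq_planPay hx]
  have hsum := G.hasSum_planPay n (w := fun i : Bool => cond i a b) (hw1 ▸ hasSum_fintype _)
    (σ₁ := fun _ => x.1) (c := fun _ => StopRule.survival x.2) (σ₂ := fun i => cond i σ σ')
    (τ₁ := x.1) (d := StopRule.survival x.2) (τ₂ := τ) fun l x m => by
      rw [hτ, Finset.mul_sum]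
      simp only [mul_left_comm _ (cond _ a b)]
      exact hasSum_fintype _
  rw [hsum.unique (hasSum_fintype _)]
  simp

end CumulativeGame

/-! ### Values of the truncated games, non-randomized rules, and the conclusion. -/

theorem randomlyStopsBy_mono (A S : Type*) : Monotone (RandomlyStopsBy A S) :=
  fun _ _ hmn _ hx s hs h => (hx s hs h).trans hmn

theorem stopsBy_mono (A S : Type*) : Monotone (StopsBy A S) :=
  fun _ _ hmn _ hx h => (hx h).trans hmn

theorem CumulativeGame.nonempty_actions_prod_signals {A₁ A₂ S₁ S₂ : Type*}
    (G : CumulativeGame A₁ A₂ S₁ S₂) [Nonempty A₁] : Nonempty (A₁ × S₁) :=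
  ⟨(Classical.arbitrary A₁, (G.p₁ []).support_nonempty.some)⟩

namespace CumulativeGame

variable {A₁ A₂ S₁ S₂ : Type*} (G : CumulativeGame A₁ A₂ S₁ S₂)
  [Finite A₁] [Finite A₂] [Finite S₁] [Finite S₂]

theorem nonempty_behavioralStrategy {A S : Type*} [Nonempty A] :
    Nonempty (BehavioralStrategy A S) :=
  ⟨fun _ => PMF.pure (Classical.arbitrary A)⟩

/-- Truncated games with random stop rules have values. -/
theorem exists_isValue_randomlyStopsBy [Nonempty A₁] [Nonempty A₂] (hG : G.LeavableBounded)
    (n : ℕ) :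
    ∃ v : ℝ, ZeroSum.IsValue G.randomizedLeavablePay (RandomlyStopsBy A₁ S₁ n) v ∧
      ∃ y, ZeroSum.minVal G.randomizedLeavablePay (RandomlyStopsBy A₁ S₁ n) y = v := by
  have := G.nonempty_actions_prod_signals
  obtain ⟨B, hB⟩ := hG
  have : Nonempty (BehavioralStrategy A₂ S₂) := nonempty_behavioralStrategy
  obtain ⟨σ₁⟩ : Nonempty (BehavioralStrategy A₁ S₁) := nonempty_behavioralStrategy
  exact ZeroSum.exists_isValue_and_minVal_eq
    ⟨_, pure_mem_randomlyStopsBy (x := (σ₁, StopRule.const A₁ S₁ n)) fun _ => le_rfl⟩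
    (fun x _ => G.abs_randomizedLeavablePay_le hB x) (G.concaveMax_randomizedLeavablePay n)
    (G.convexMin_randomizedLeavablePay n)
    (G.compactMin_randomizedLeavablePay.mono (Set.subset_iUnion _ n))

/-- A random stop rule need not be bounded, but each rule in its support is, and the bound `c`
survives averaging. -/
theorem randomizedLeavablePay_le_of_stopsBy (hG : G.LeavableBounded) {σ₂ : BehavioralStrategy A₂ S₂}
    {c : ℝ} (h : ∀ n, ∀ x ∈ StopsBy A₁ S₁ n, G.leavablePay x σ₂ ≤ c)
    (x : BehavioralStrategy A₁ S₁ × PMF (StopRule A₁ S₁)) :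
    G.randomizedLeavablePay x σ₂ ≤ c :=
  G.randomizedLeavablePay_le hG fun s => by
    obtain ⟨n, hn⟩ := s.exists_time_le
    exact h n (x.1, s) hn

theorem compactMin_leavablePay [Nonempty (A₁ × S₁)] :
    ZeroSum.CompactMin G.leavablePay (⋃ n, StopsBy A₁ S₁ n) := by
  classical
  intro E hE hF
  obtain ⟨y, hy⟩ := G.compactMin_randomizedLeavablePay
    ((fun p => ((p.1.1, PMF.pure p.1.2), p.2)) '' E) (by
      rintro _ ⟨p, hp, rfl⟩
      obtain ⟨n, hn⟩ := Set.mem_iUnion.1 (hE p hp)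
      exact Set.mem_iUnion.2 ⟨n, pure_mem_randomlyStopsBy hn⟩) (by
      intro F hFE
      obtain ⟨F', hF', rfl⟩ := Finset.subset_set_image_iff.1 hFE
      obtain ⟨y, hy⟩ := hF F' hF'
      refine ⟨y, fun q hq => ?_⟩
      obtain ⟨p, hp, rfl⟩ := Finset.mem_image.1 hq
      rw [randomizedLeavablePay_pure]
      exact hy p hp)
  refine ⟨y, fun p hp => ?_⟩
  have := hy _ ⟨p, hp, rfl⟩
  rwa [randomizedLeavablePay_pure] at this

/-- With non-negative daily payoffs, stopping at the last possible time is at least as good as any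
random stop rule. -/
theorem randomizedLeavablePay_le_const [Nonempty (A₁ × S₁)] (hf : ∀ h, 0 ≤ G.f h) {n : ℕ}
    {x : BehavioralStrategy A₁ S₁ × PMF (StopRule A₁ S₁)} (hx : x ∈ RandomlyStopsBy A₁ S₁ n)
    (σ₂ : BehavioralStrategy A₂ S₂) :
    G.randomizedLeavablePay x σ₂ ≤ G.leavablePay (x.1, StopRule.const A₁ S₁ n) σ₂ := by
  have := Fintype.ofFinite (Stage A₁ A₂ S₁ S₂)
  rw [G.randomizedLeavablePay_eq_planPay hx,
    G.leavablePay_eq_planPay _ (StopRule.const A₁ S₁ n) fun _ => le_rfl]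
  refine G.planPay_mono hf _ (fun l hl => ?_) σ₂
  rw [StopRule.alive, if_pos (by exact hl)]
  exact (StopRule.isSurvival_survival x.2).le_one l

/-- Point masses embed the non-randomized rules among the random ones; conversely the constant rule
`n` dominates every random rule. -/
theorem minVal_stopsBy [Nonempty (A₁ × S₁)] (hf : ∀ h, 0 ≤ G.f h) (n : ℕ)
    (σ₂ : BehavioralStrategy A₂ S₂) :
    ZeroSum.minVal G.leavablePay (StopsBy A₁ S₁ n) σ₂ =
      ZeroSum.minVal G.randomizedLeavablePay (RandomlyStopsBy A₁ S₁ n) σ₂ := by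
  refine le_antisymm (iSup₂_le fun x hx => ?_) (iSup₂_le fun x hx => ?_)
  · rw [← randomizedLeavablePay_pure]
    exact le_iSup₂ (f := fun x (_ : x ∈ RandomlyStopsBy A₁ S₁ n) =>
      (G.randomizedLeavablePay x σ₂ : EReal)) _ (pure_mem_randomlyStopsBy hx)
  · exact (EReal.coe_le_coe_iff.2 (G.randomizedLeavablePay_le_const hf hx σ₂)).trans
      (le_iSup₂ (f := fun x (_ : x ∈ StopsBy A₁ S₁ n) => (G.leavablePay x σ₂ : EReal))
        (x.1, StopRule.const A₁ S₁ n) fun _ => le_rfl)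

theorem lowerVal_stopsBy [Nonempty (A₁ × S₁)] (hf : ∀ h, 0 ≤ G.f h) (n : ℕ) :
    ZeroSum.lowerVal G.leavablePay (StopsBy A₁ S₁ n) =
      ZeroSum.lowerVal G.randomizedLeavablePay (RandomlyStopsBy A₁ S₁ n) := by
  refine le_antisymm (iSup₂_le fun x hx => ?_) (iSup₂_le fun x hx => ?_)
  · refine le_trans (le_of_eq ?_)
      (ZeroSum.maxVal_le_lowerVal G.randomizedLeavablePay (pure_mem_randomlyStopsBy hx))
    simp only [ZeroSum.maxVal, randomizedLeavablePay_pure]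
  · exact (iInf_mono fun σ₂ =>
      EReal.coe_le_coe_iff.2 (G.randomizedLeavablePay_le_const hf hx σ₂)).trans
        (ZeroSum.maxVal_le_lowerVal G.leavablePay (D := StopsBy A₁ S₁ n)
          (x := (x.1, StopRule.const A₁ S₁ n)) fun _ => le_rfl)

end CumulativeGame

theorem theorem3 {A₁ A₂ S₁ S₂ : Type*} [Finite A₁] [Finite A₂] [Finite S₁] [Finite S₂]
    [Nonempty A₁] [Nonempty A₂]
    (G : CumulativeGame A₁ A₂ S₁ S₂) (hG : G.LeavableBounded) :
    (ZeroSum.HasUniformValue G.randomizedLeavablePay (RandomlyStopsBy A₁ S₁) ∧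
      ∃ σ₂ : BehavioralStrategy A₂ S₂,
        ZeroSum.OptimalMin G.randomizedLeavablePay Set.univ σ₂) ∧
    ((∀ h, 0 ≤ G.f h) →
      ZeroSum.HasUniformValue G.leavablePay (StopsBy A₁ S₁) ∧
      ∃ σ₂ : BehavioralStrategy A₂ S₂,
        ZeroSum.OptimalMin G.leavablePay Set.univ σ₂) := by
  have := G.nonempty_actions_prod_signals
  obtain ⟨B, hB⟩ := id hG
  refine ⟨ZeroSum.hasUniformValue_and_exists_optimalMin (randomlyStopsBy_mono A₁ S₁)
    (G.abs_randomizedLeavablePay_le hB) (G.exists_isValue_randomlyStopsBy hG)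
    G.compactMin_randomizedLeavablePay fun σ₂ c h => ?_, fun hf => ?_⟩
  · refine G.randomizedLeavablePay_le_of_stopsBy hG fun n x hx => ?_
    rw [← G.randomizedLeavablePay_pure]
    exact h n _ (CumulativeGame.pure_mem_randomlyStopsBy hx)
  · refine ZeroSum.hasUniformValue_and_exists_optimalMin (stopsBy_mono A₁ S₁)
      (G.abs_leavablePay_le hB) (fun n => ?_) G.compactMin_leavablePay fun σ₂ c h x => ?_
    -- The value is transferred from the randomized game, so no concavity is needed for
    -- non-randomized rules.
    · obtain ⟨v, ⟨hlow, hup⟩, y, hy⟩ := G.exists_isValue_randomlyStopsBy hG n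
      refine ⟨v, ⟨by rw [G.lowerVal_stopsBy hf, hlow], ?_⟩, y, by rw [G.minVal_stopsBy hf, hy]⟩
      simp only [ZeroSum.upperVal, G.minVal_stopsBy hf]
      exact hup
    · obtain ⟨n, hn⟩ := x.2.exists_time_le
      exact h n x hn
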